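/- Let $V$ be a countable set and let $(V,\mu,m)$ be a weighted graph: $\mu:V\times V\to[0,\infty)$, $(x,y)\mapsto\mu_{xy}$, is symmetric with $\sum_{y}\mu_{xy}<\infty$ for every $x\in V$, and $m:V\to(0,\infty)$. Write $x\sim y$ if $\mu_{xy}>0$. Let $\ell^2_m$ be the real Hilbert space of functions with $\sum_x f(x)^2m_x<\infty$, with inner product $\langle f,g\rangle=\sum_x f(x)g(x)m_x$. Let $\widetilde Q(f)=\frac12\sum_{x,y}\mu_{xy}|f(x)-f(y)|^2\in[0,\infty]$, let $Q$ be the Dirichlet form obtained by closing the restriction of $\widetilde Q$ to the finitely supported functions in $\ell^2_m$ (with respect to convergence in $\ell^2_m$ and in $\widetilde Q$), and let $\Delta\le 0$ be its (possibly unbounded) generator, the Laplacian: $u\in D(\Delta)$ with $\Delta u=w$ if and only if $u\in D(Q)$, $w\in\ell^2_m$ and $Q(u,v)=-\langle w,v\rangle$ for all $v\in D(Q)$. Let $\rho:V\times V\to[0,\infty)$ be an intrinsic pseudo metric, i.e. symmetric, zero on the diagonal, satisfying the triangle inequality, and with $\sum_y\mu_{xy}\rho(x,y)^2\le m_x$ for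 all $x\in V$; assume that its jump size $s=\sup\{\rho(x,y): x\sim y\}$ satisfies $0<s<\infty$. Then $\Delta$ generates a strongly continuous semigroup $(e^{t\Delta})_{t\ge0}$ on $\ell^2_m$, and for all $A,B\subseteq V$, all $f,g\in\ell^2_m$ with $\operatorname{supp}f\subseteq A$ and $\operatorname{supp}g\subseteq B$, and all $t>0$, $$|\langle e^{t\Delta}f,g\rangle|\le e^{-\lambda t-\zeta_s(t,\rho(A,B))}\,\|f\|_{\ell^2_m}\|g\|_{\ell^2_m},$$ where $\lambda$ is the bottom (infimum) of the $\ell^2$-spectrum of $-\Delta$, $\rho(A,B)=\inf\{\rho(x,y):x\in A,\ y\in B\}$ (any value may be used if $A$ or $B$ is empty, since then both sides vanish), and $$\zeta_s(t,r)=\frac1{s^2}\left(rs\,\operatorname{arsinh}\frac{rs}{t}-\sqrt{t^2+r^2s^2}+t\right),\qquad t>0,\ r\ge0.$$ -/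

import Mathlib

open MeasureTheory Filter Topology
open scoped ENNReal NNReal RealInnerProductSpace

section Operators

variable {H : Type*} [NormedAddCommGroup H] [InnerProductSpace ℝ H]

/-- The resolvent set of a (possibly unbounded) operator `A` on `H`: the `z` for which `z - A`
maps the domain of `A` bijectively onto `H` with a bounded inverse `R`. -/
def pmapResolventSet (A : H →ₗ.[ℝ] H) : Set ℝ :=
  {z | ∃ R : H →L[ℝ] H,
    (∀ f : H, ∃ u : A.domain, (u : H) = R f ∧ z • (u : H) - A u = f) ∧
    ∀ u : A.domain, R (z • (u : H) - A u) = u}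

/-- The (real) spectrum of a possibly unbounded operator. For the self-adjoint operators used
here this is the whole spectrum. -/
def pmapSpectrum (A : H →ₗ.[ℝ] H) : Set ℝ := (pmapResolventSet A)ᶜ

variable (H) in
/-- Strongly continuous one-parameter semigroups of bounded operators on `H`. -/
structure C0Semigroup where
  toFun : ℝ≥0 → H →L[ℝ] H
  map_zero : toFun 0 = ContinuousLinearMap.id ℝ H
  map_add : ∀ s t : ℝ≥0, toFun (s + t) = (toFun s).comp (toFun t)
  continuous_apply : ∀ f : H, Continuous fun t : ℝ≥0 => toFun t f

namespace C0Semigroup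

instance : CoeFun (C0Semigroup H) (fun _ => ℝ≥0 → H →L[ℝ] H) := ⟨toFun⟩

instance : Nonempty (C0Semigroup H) :=
  ⟨⟨fun _ => ContinuousLinearMap.id ℝ H, rfl, fun _ _ => rfl, fun _ => continuous_const⟩⟩

/-- The graph of the generator: the pairs `(f, g)` with `(T t f - f) / t → g` as `t ↓ 0`. -/
def generatorGraph (T : C0Semigroup H) : Submodule ℝ (H × H) where
  carrier := {p | Tendsto (fun t : ℝ≥0 => (t : ℝ)⁻¹ • (T t p.1 - p.1)) (𝓝[>] 0) (𝓝 p.2)}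
  add_mem' := by
    intro p q hp hq
    refine (Tendsto.add hp hq).congr fun t => ?_
    simp only [Prod.fst_add, _root_.map_add, ← smul_add]
    congr 1
    abel
  zero_mem' := by simp
  smul_mem' := by
    intro c p hp
    refine (Tendsto.const_smul hp c).congr fun t => ?_
    simp only [Prod.smul_fst, _root_.map_smul]
    rw [smul_comm c, smul_sub]

theorem generatorGraph_single_valued (T : C0Semigroup H) (p : H × H)
    (hp : p ∈ T.generatorGraph) (h0 : p.1 = 0) : p.2 = 0 := by
  have h : Tendsto (fun t : ℝ≥0 => (t : ℝ)⁻¹ • (T t p.1 - p.1)) (𝓝[>] 0) (𝓝 p.2) := hp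
  simp only [h0, _root_.map_zero, sub_zero, smul_zero] at h
  exact (tendsto_nhds_unique h tendsto_const_nhds)

/-- The (infinitesimal) generator of a strongly continuous semigroup. -/
noncomputable def generator (T : C0Semigroup H) : H →ₗ.[ℝ] H := T.generatorGraph.toLinearPMap

theorem graph_generator (T : C0Semigroup H) : T.generator.graph = T.generatorGraph :=
  Submodule.toLinearPMap_graph_eq _ T.generatorGraph_single_valued

end C0Semigroup

/-- `expSemigroup A` is the strongly continuous semigroup `(e^{tA})_{t ≥ 0}` generated by `A`
(it is unique whenever it exists). -/
noncomputable def expSemigroup (A : H →ₗ.[ℝ] H) : C0Semigroup H :=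
  Classical.epsilon fun T : C0Semigroup H => T.generator = A

end Operators

/-- A weighted graph `(V, μ, m)`; self-loops and infinite degrees are allowed. -/
structure WeightedGraph (V : Type*) where
  μ : V → V → ℝ
  m : V → ℝ
  μ_nonneg : ∀ x y, 0 ≤ μ x y
  μ_symm : ∀ x y, μ x y = μ y x
  μ_summable : ∀ x, Summable fun y => μ x y
  m_pos : ∀ x, 0 < m x

namespace WeightedGraph

variable {V : Type*}

/-- `x ∼ y`: the vertices `x` and `y` are joined by an edge. -/
def Adj (G : WeightedGraph V) (x y : V) : Prop := 0 < G.μ x y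

/-- A pseudo metric is intrinsic if `∑ y, μ x y * ρ x y ^ 2 ≤ m x` for all `x`. -/
def IsIntrinsic (G : WeightedGraph V) (ρ : PseudoMetric V ℝ) : Prop :=
  ∀ x, Summable (fun y => G.μ x y * ρ x y ^ 2) ∧ ∑' y, G.μ x y * ρ x y ^ 2 ≤ G.m x

/-- The jump size `sup {ρ x y | x ∼ y} ∈ [0, ∞]`. -/
noncomputable def jumpSize (G : WeightedGraph V) (ρ : PseudoMetric V ℝ) : ℝ≥0∞ :=
  ⨆ (x : V) (y : V) (_ : G.Adj x y), ENNReal.ofReal (ρ x y)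

/-- The quadratic form `Q̃(f) = 1/2 ∑ x y, μ x y * |f x - f y| ^ 2 ∈ [0, ∞]` on all functions. -/
noncomputable def energy (G : WeightedGraph V) (f : V → ℝ) : ℝ≥0∞ :=
  2⁻¹ * ∑' p : V × V, ENNReal.ofReal (G.μ p.1 p.2 * (f p.1 - f p.2) ^ 2)

/-- The bilinear form `1/2 ∑ x y, μ x y * (f x - f y) * (g x - g y)`; the sum converges
absolutely when `f` and `g` have finite energy. -/
noncomputable def form (G : WeightedGraph V) (f g : V → ℝ) : ℝ :=
  2⁻¹ * ∑' p : V × V, G.μ p.1 p.2 * (f p.1 - f p.2) * (g p.1 - g p.2)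

theorem energy_smul (G : WeightedGraph V) (c : ℝ) (f : V → ℝ) :
    G.energy (c • f) = ENNReal.ofReal (c ^ 2) * G.energy f := by
  unfold energy
  rw [mul_left_comm]
  congr 1
  rw [← ENNReal.tsum_mul_left]
  refine tsum_congr fun p => ?_
  rw [← ENNReal.ofReal_mul (sq_nonneg c)]
  congr 1
  simp only [Pi.smul_apply, smul_eq_mul]
  ring

theorem energy_add_le (G : WeightedGraph V) (f g : V → ℝ) :
    G.energy (f + g) ≤ 2 * (G.energy f + G.energy g) := by
  unfold energy
  rw [← mul_add, ← ENNReal.tsum_add, mul_left_comm]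
  gcongr 2⁻¹ * ?_
  rw [← ENNReal.tsum_mul_left]
  refine ENNReal.tsum_le_tsum fun p => ?_
  have h := G.μ_nonneg p.1 p.2
  rw [← ENNReal.ofReal_add (by positivity) (by positivity),
    show (2 : ℝ≥0∞) = ENNReal.ofReal 2 by simp, ← ENNReal.ofReal_mul (by norm_num)]
  refine ENNReal.ofReal_le_ofReal ?_
  simp only [Pi.add_apply]
  nlinarith [mul_nonneg h (sq_nonneg ((f p.1 - f p.2) - (g p.1 - g p.2)))]

theorem energy_ne_top_of_finite (G : WeightedGraph V) (f : V → ℝ)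
    (hf : (Function.support f).Finite) : G.energy f ≠ ∞ := by
  have key : ∑' p : V × V, ENNReal.ofReal (G.μ p.1 p.2 * f p.1 ^ 2) ≠ ∞ := by
    rw [ENNReal.tsum_prod']
    rw [tsum_eq_sum (s := hf.toFinset)]
    · refine ENNReal.sum_ne_top.2 fun x _ => ?_
      have := (G.μ_summable x).mul_right (f x ^ 2)
      rw [← ENNReal.ofReal_tsum_of_nonneg
        (fun y => mul_nonneg (G.μ_nonneg x y) (sq_nonneg _)) this]
      exact ENNReal.ofReal_ne_top
    · intro x hx
      have hx0 : f x = 0 := by simpa using hx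
      simp [hx0]
  have key2 : ∑' p : V × V, ENNReal.ofReal (G.μ p.1 p.2 * f p.2 ^ 2) ≠ ∞ := by
    rw [← (Equiv.prodComm V V).tsum_eq]
    simpa [G.μ_symm] using key
  unfold energy
  refine ENNReal.mul_ne_top (by simp) ?_
  refine ne_top_of_le_ne_top
    (ENNReal.mul_ne_top (ENNReal.ofReal_ne_top (r := 2)) (ENNReal.add_ne_top.2 ⟨key, key2⟩)) ?_
  rw [← ENNReal.tsum_add, ← ENNReal.tsum_mul_left]
  gcongr with p
  have h := G.μ_nonneg p.1 p.2
  rw [← ENNReal.ofReal_add (by positivity) (by positivity), ← ENNReal.ofReal_mul (by norm_num)]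
  refine ENNReal.ofReal_le_ofReal ?_
  nlinarith [mul_nonneg h (sq_nonneg (f p.1 + f p.2))]

theorem summable_of_energy_ne_top (G : WeightedGraph V) {f : V → ℝ} (hf : G.energy f ≠ ∞) :
    Summable fun p : V × V => G.μ p.1 p.2 * (f p.1 - f p.2) ^ 2 := by
  have h1 : ∑' p : V × V, ENNReal.ofReal (G.μ p.1 p.2 * (f p.1 - f p.2) ^ 2) ≠ ∞ := by
    intro h
    apply hf
    unfold energy
    rw [h]
    simp
  have h2 := ENNReal.summable_toReal h1
  refine h2.congr fun p => ?_
  rw [ENNReal.toReal_ofReal (mul_nonneg (G.μ_nonneg _ _) (sq_nonneg _))]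

theorem summable_form (G : WeightedGraph V) {f g : V → ℝ} (hf : G.energy f ≠ ∞)
    (hg : G.energy g ≠ ∞) :
    Summable fun p : V × V => G.μ p.1 p.2 * (f p.1 - f p.2) * (g p.1 - g p.2) := by
  refine Summable.of_norm_bounded
    ((G.summable_of_energy_ne_top hf).add (G.summable_of_energy_ne_top hg)) fun p => ?_
  have h := G.μ_nonneg p.1 p.2
  rw [Real.norm_eq_abs, abs_le]
  constructor <;>
  nlinarith [mul_nonneg h (sq_nonneg ((f p.1 - f p.2) - (g p.1 - g p.2))),
    mul_nonneg h (sq_nonneg ((f p.1 - f p.2) + (g p.1 - g p.2))),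
    mul_nonneg h (sq_nonneg (f p.1 - f p.2)), mul_nonneg h (sq_nonneg (g p.1 - g p.2))]

variable [MeasurableSpace V] [DiscreteMeasurableSpace V]

/-- The measure on `V` with mass `m x` at each vertex `x`. -/
noncomputable def measure (G : WeightedGraph V) : Measure V :=
  Measure.sum fun x => ENNReal.ofReal (G.m x) • Measure.dirac x

/-- The Hilbert space `ℓ²_m` of real functions, square summable with respect to `m`. -/
abbrev ell2 (G : WeightedGraph V) : Type _ := Lp ℝ 2 G.measure

theorem measure_singleton (G : WeightedGraph V) (x : V) :
    G.measure {x} = ENNReal.ofReal (G.m x) := by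
  classical
  unfold measure
  rw [Measure.sum_apply _ (MeasurableSet.of_discrete)]
  rw [tsum_eq_single x]
  · simp
  · intro y hy
    simp [hy]

/-- Since every vertex has positive mass, "almost everywhere" means "everywhere". -/
theorem forall_of_ae (G : WeightedGraph V) {P : V → Prop} (h : ∀ᵐ x ∂G.measure, P x) (x : V) :
    P x := by
  by_contra hx
  have h0 : G.measure {x} = 0 :=
    measure_mono_null (Set.singleton_subset_iff.2 hx) (ae_iff.1 h)
  rw [measure_singleton, ENNReal.ofReal_eq_zero] at h0
  exact absurd (G.m_pos x) (not_lt.2 h0)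

theorem coe_add (G : WeightedGraph V) (u v : G.ell2) : ⇑(u + v) = ⇑u + ⇑v :=
  funext (G.forall_of_ae (Lp.coeFn_add u v))

theorem coe_smul (G : WeightedGraph V) (c : ℝ) (u : G.ell2) : ⇑(c • u) = c • ⇑u :=
  funext (G.forall_of_ae (Lp.coeFn_smul c u))

theorem coe_zero (G : WeightedGraph V) : ⇑(0 : G.ell2) = 0 :=
  funext (G.forall_of_ae (Lp.coeFn_zero ℝ 2 G.measure))

/-- The domain of the Dirichlet form `Q`: the closure of the finitely supported functions
with respect to convergence in `ℓ²_m` together with convergence in energy. -/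
def formDomain (G : WeightedGraph V) : Submodule ℝ G.ell2 where
  carrier := {u | ∃ φ : ℕ → G.ell2, (∀ n, (Function.support (φ n)).Finite) ∧
    Tendsto φ atTop (𝓝 u) ∧ Tendsto (fun n => G.energy (⇑u - ⇑(φ n))) atTop (𝓝 0)}
  add_mem' := by
    rintro u v ⟨φ, hφ, hφu, hφe⟩ ⟨ψ, hψ, hψv, hψe⟩
    refine ⟨fun n => φ n + ψ n, fun n => ?_, hφu.add hψv, ?_⟩
    · rw [coe_add]
      exact ((hφ n).union (hψ n)).subset (Function.support_add _ _)
    · have h : Tendsto (fun n => 2 * (G.energy (⇑u - ⇑(φ n)) + G.energy (⇑v - ⇑(ψ n))))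
          atTop (𝓝 0) := by
        have := ENNReal.Tendsto.const_mul (a := 2) (hφe.add hψe) (Or.inr (by simp))
        simpa using this
      refine tendsto_of_tendsto_of_tendsto_of_le_of_le tendsto_const_nhds h
        (fun _ => zero_le) fun n => ?_
      simp only [coe_add]
      rw [add_sub_add_comm]
      exact G.energy_add_le _ _
  zero_mem' := by
    refine ⟨fun _ => 0, fun _ => ?_, tendsto_const_nhds, ?_⟩
    · rw [coe_zero]
      simp
    · simp [energy]
  smul_mem' := by
    rintro c u ⟨φ, hφ, hφu, hφe⟩
    refine ⟨fun n => c • φ n, fun n => ?_, hφu.const_smul c, ?_⟩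
    · rw [coe_smul]
      exact (hφ n).subset (Function.support_const_smul_subset c _)
    · simp only [coe_smul, ← smul_sub, energy_smul]
      have := ENNReal.Tendsto.const_mul (a := ENNReal.ofReal (c ^ 2)) hφe (Or.inr (by simp))
      simpa using this

theorem energy_ne_top (G : WeightedGraph V) {u : G.ell2} (hu : u ∈ G.formDomain) :
    G.energy u ≠ ∞ := by
  obtain ⟨φ, hφ, -, hφe⟩ := hu
  obtain ⟨n, hn⟩ := (hφe.eventually (gt_mem_nhds (zero_lt_one (α := ℝ≥0∞)))).exists
  have h := G.energy_add_le (⇑u - ⇑(φ n)) (⇑(φ n))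
  rw [sub_add_cancel] at h
  exact ne_top_of_le_ne_top (ENNReal.mul_ne_top (by simp) (ENNReal.add_ne_top.2
    ⟨(hn.trans ENNReal.one_lt_top).ne, G.energy_ne_top_of_finite _ (hφ n)⟩)) h

/-- The graph of the generator of the Dirichlet form: the pairs `(u, w)` with `u` in the form
domain and `Q(u, v) = -⟨w, v⟩` for all `v` in the form domain. -/
def laplacianGraph (G : WeightedGraph V) : Submodule ℝ (G.ell2 × G.ell2) where
  carrier := {p | p.1 ∈ G.formDomain ∧ ∀ v ∈ G.formDomain, G.form p.1 v = -⟪p.2, v⟫}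
  add_mem' := by
    rintro p q ⟨hp, hp'⟩ ⟨hq, hq'⟩
    refine ⟨add_mem hp hq, fun v hv => ?_⟩
    rw [Prod.snd_add, inner_add_left, neg_add, ← hp' v hv, ← hq' v hv, Prod.fst_add, coe_add]
    unfold form
    rw [← mul_add, ← (G.summable_form (G.energy_ne_top hp) (G.energy_ne_top hv)).tsum_add
      (G.summable_form (G.energy_ne_top hq) (G.energy_ne_top hv))]
    refine congrArg _ (tsum_congr fun x => ?_)
    simp only [Pi.add_apply]
    ring
  zero_mem' := by
    refine ⟨zero_mem _, fun v _ => ?_⟩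
    rw [Prod.fst_zero, Prod.snd_zero, coe_zero]
    simp [form]
  smul_mem' := by
    rintro c p ⟨hp, hp'⟩
    refine ⟨Submodule.smul_mem _ c hp, fun v hv => ?_⟩
    rw [Prod.smul_snd, real_inner_smul_left, ← mul_neg, ← hp' v hv, Prod.smul_fst, coe_smul]
    unfold form
    rw [mul_left_comm]
    congr 1
    rw [← tsum_mul_left]
    refine tsum_congr fun x => ?_
    simp only [Pi.smul_apply, smul_eq_mul]
    ring

theorem laplacianGraph_single_valued (G : WeightedGraph V) (p : G.ell2 × G.ell2)
    (hp : p ∈ G.laplacianGraph) (h0 : p.1 = 0) : p.2 = 0 := by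
  classical
  obtain ⟨-, h⟩ := hp
  have hzero : ∀ x, p.2 x = 0 := by
    intro x
    have hfin : G.measure {x} ≠ ∞ := by rw [measure_singleton]; exact ENNReal.ofReal_ne_top
    set δ : G.ell2 := indicatorConstLp 2 (MeasurableSet.singleton x) hfin (1 : ℝ) with hδ
    have hδs : (Function.support δ).Finite := by
      refine (Set.finite_singleton x).subset fun y hy => ?_
      by_contra hyx
      exact hy ((G.forall_of_ae indicatorConstLp_coeFn_notMem y) hyx)
    have hδD : δ ∈ G.formDomain :=
      ⟨fun _ => δ, fun _ => hδs, tendsto_const_nhds, by simp [energy]⟩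
    have h1 := h δ hδD
    rw [h0, coe_zero, real_inner_comm, hδ, L2.inner_indicatorConstLp_one, Measure.restrict_singleton,
      integral_smul_measure, integral_dirac, measure_singleton,
      ENNReal.toReal_ofReal (G.m_pos x).le] at h1
    have h2 : G.m x * p.2 x = 0 := by
      simpa [form, eq_comm] using h1
    exact (mul_eq_zero.1 h2).resolve_left (G.m_pos x).ne'
  refine Lp.ext (Eventually.of_forall fun x => ?_)
  rw [hzero x, coe_zero, Pi.zero_apply]

/-- The Laplacian `Δ` of the weighted graph: the (non-positive, possibly unbounded) generator
of the Dirichlet form `Q` on `ℓ²_m`. -/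
noncomputable def laplacian (G : WeightedGraph V) : G.ell2 →ₗ.[ℝ] G.ell2 :=
  G.laplacianGraph.toLinearPMap

theorem graph_laplacian (G : WeightedGraph V) : G.laplacian.graph = G.laplacianGraph :=
  Submodule.toLinearPMap_graph_eq _ G.laplacianGraph_single_valued

/-- The bottom of the `ℓ²`-spectrum of the (non-negative) operator `-Δ`. -/
noncomputable def spectralBottom (G : WeightedGraph V) : ℝ :=
  sInf (pmapSpectrum (-G.laplacian))

/-- The heat semigroup `(e^{tΔ})_{t ≥ 0}` on `ℓ²_m`. -/
noncomputable def heatSemigroup (G : WeightedGraph V) : C0Semigroup G.ell2 :=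
  expSemigroup G.laplacian

end WeightedGraph

/-- The distance `ρ(A, B) = inf {ρ x y | x ∈ A, y ∈ B}`. -/
noncomputable def setDist {V : Type*} (ρ : PseudoMetric V ℝ) (A B : Set V) : ℝ :=
  sInf (Set.image2 (fun x y => ρ x y) A B)

/-- `ζ_s(t, r) = s⁻² (r s arsinh (r s / t) - √(t² + r² s²) + t)`. -/
noncomputable def zeta (s t r : ℝ) : ℝ :=
  1 / s ^ 2 * (r * s * Real.arsinh (r * s / t) - √(t ^ 2 + r ^ 2 * s ^ 2) + t)

/-! Davies' method. Let `d` be the distance to `A`, cut off at `r = ρ(A, B)`: it is 1-Lipschitz,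
vanishes on `A` and equals `r` on `B`. Multiplication `M` by `e^{κd}` is bounded and symmetric,
fixes `f` and multiplies `g` by `e^{κr}`, so `⟨e^{tΔ}f, g⟩ = e^{-κr}⟨M e^{tΔ}f, g⟩`, and it remains
to bound the growth of `‖M e^{tΔ}f‖`.

With `φ = κd` and `v = e^φ u`, the algebraic identity `(u x - u y)(e^{2φ}u x - e^{2φ}u y) = (v x - v
y)² - 2 v x v y (cosh(φ x - φ y) - 1)` expresses the form. Along an edge `ρ ≤ s`, so `cosh(φ x - φ
y) - 1 ≤ cρ²` with `c = (cosh(κs) - 1)/s²`, and the intrinsic condition sums the error to at most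
`c‖v‖²` (`IsIntrinsic.form_exp_mul_ge`). Together with the Poincaré inequality `λ‖v‖² ≤ Q(v)`
(`spectralBottom_mul_norm_sq_le`), Grönwall's lemma gives `‖M e^{tΔ}f‖ ≤ e^{(c-λ)t}‖Mf‖`. Minimising
`ct - κr` over `κ` gives `sinh(κs) = rs/t` and the value `-ζ_s(t, r)`.

Two foundations are needed. The operator `Δ` generates a semigroup because it is maximal
dissipative: `α - Δ` is inverted by an orthogonal projection onto the graph of the gradient, and the
Hilbert space Lumer–Phillips theorem follows by Yosida approximation. The Poincaré inequality is
derived directly from the resolvent definition of the spectrum, without a spectral theorem. -/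

/-! ### Exponentials of bounded dissipative operators -/

section BoundedSemigroups

variable {H : Type*} [NormedAddCommGroup H] [InnerProductSpace ℝ H]

theorem commute_exp_smul_of_commute {Y Z : H →L[ℝ] H} (h : Commute Y Z) (t : ℝ) :
    Commute (NormedSpace.exp (t • Y)) Z :=
  (h.smul_left t).exp_left

variable [CompleteSpace H]

theorem hasDerivAt_exp_smul_apply (Y : H →L[ℝ] H) (f : H) (t : ℝ) :
    HasDerivAt (fun t : ℝ => NormedSpace.exp (t • Y) f) (NormedSpace.exp (t • Y) (Y f)) t := by
  simpa using (hasDerivAt_exp_smul_const (𝕂 := ℝ) Y t).clm_apply (hasDerivAt_const t f)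

/-- The derivative of `‖e^{tY}f‖²` is `2⟨Y e^{tY}f, e^{tY}f⟩ ≤ 0`. -/
theorem norm_exp_smul_apply_le {Y : H →L[ℝ] H} (hY : ∀ f, ⟪Y f, f⟫ ≤ 0) (f : H) {t : ℝ}
    (ht : 0 ≤ t) : ‖NormedSpace.exp (t • Y) f‖ ≤ ‖f‖ := by
  have hd : ∀ t : ℝ, HasDerivAt (fun t : ℝ => ‖NormedSpace.exp (t • Y) f‖ ^ 2)
      (2 * ⟪NormedSpace.exp (t • Y) f, NormedSpace.exp (t • Y) (Y f)⟫) t := fun t =>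
    (hasDerivAt_exp_smul_apply Y f t).norm_sq
  have hanti : Antitone fun t : ℝ => ‖NormedSpace.exp (t • Y) f‖ ^ 2 := by
    refine antitone_of_hasDerivAt_nonpos hd fun t => ?_
    have hc : NormedSpace.exp (t • Y) (Y f) = Y (NormedSpace.exp (t • Y) f) :=
      DFunLike.congr_fun (commute_exp_smul_of_commute (Commute.refl Y) t).eq f
    rw [Pi.zero_apply, hc, real_inner_comm]
    linarith [hY (NormedSpace.exp (t • Y) f)]
  have h := hanti ht
  simp only [zero_smul, NormedSpace.exp_zero, one_apply_eq_self] at h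
  exact le_of_sq_le_sq h (norm_nonneg _)

/-- Interpolate by `r ↦ e^{rY}e^{(t-r)Z}f`, whose derivative is `e^{rY}e^{(t-r)Z}(Y - Z)f` by
commutativity; both exponentials are contractions. -/
theorem norm_exp_smul_apply_sub_le {Y Z : H →L[ℝ] H} (hY : ∀ f, ⟪Y f, f⟫ ≤ 0)
    (hZ : ∀ f, ⟪Z f, f⟫ ≤ 0) (hc : Commute Y Z) (f : H) {t : ℝ} (ht : 0 ≤ t) :
    ‖NormedSpace.exp (t • Y) f - NormedSpace.exp (t • Z) f‖ ≤ t * ‖Y f - Z f‖ := by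
  have hd : ∀ r : ℝ, HasDerivAt
      (fun r : ℝ => NormedSpace.exp (r • Y) (NormedSpace.exp ((t - r) • Z) f))
      (NormedSpace.exp (r • Y) (NormedSpace.exp ((t - r) • Z) (Y f - Z f))) r := by
    intro r
    have h1 := hasDerivAt_exp_smul_const (𝕂 := ℝ) Y r
    have h2 : HasDerivAt (fun r : ℝ => NormedSpace.exp ((t - r) • Z) f)
        (-(NormedSpace.exp ((t - r) • Z) (Z f))) r := by
      simpa [Function.comp_def] using (hasDerivAt_exp_smul_apply Z f (t - r)).scomp r
        ((hasDerivAt_id r).const_sub t)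
    convert! h1.clm_apply h2 using 1
    have h3 : NormedSpace.exp ((t - r) • Z) (Y f) = Y (NormedSpace.exp ((t - r) • Z) f) :=
      DFunLike.congr_fun (commute_exp_smul_of_commute hc.symm (t - r)).eq f
    simp only [mul_apply_eq_comp, map_sub, h3, map_neg]
    abel
  have h := norm_image_sub_le_of_norm_deriv_le_segment' (a := 0) (b := t) (C := ‖Y f - Z f‖)
    (fun r _ => (hd r).hasDerivWithinAt) (fun r hr => ?_) t ⟨ht, le_rfl⟩
  · simpa [NormedSpace.exp_zero, mul_comm] using h
  · exact (norm_exp_smul_apply_le hY _ hr.1).trans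
      (norm_exp_smul_apply_le hZ _ (sub_nonneg.2 hr.2.le))

theorem norm_exp_smul_apply_sub_self_le {Y : H →L[ℝ] H} (hY : ∀ f, ⟪Y f, f⟫ ≤ 0) (f : H) {t : ℝ}
    (ht : 0 ≤ t) : ‖NormedSpace.exp (t • Y) f - f‖ ≤ t * ‖Y f‖ := by
  simpa [NormedSpace.exp_zero] using
    norm_exp_smul_apply_sub_le hY (Z := 0) (by simp) (Commute.zero_right Y) f ht

theorem norm_exp_smul_apply_sub_sub_le {Y : H →L[ℝ] H} (f g : H) {t C : ℝ} (ht : 0 ≤ t)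
    (hC : ∀ r ∈ Set.Icc 0 t, ‖NormedSpace.exp (r • Y) (Y f) - g‖ ≤ C) :
    ‖NormedSpace.exp (t • Y) f - f - t • g‖ ≤ C * t := by
  have hd : ∀ r : ℝ, HasDerivAt (fun r : ℝ => NormedSpace.exp (r • Y) f - r • g)
      (NormedSpace.exp (r • Y) (Y f) - g) r := fun r => by
    simpa using! (hasDerivAt_exp_smul_apply Y f r).sub ((hasDerivAt_id r).smul_const g)
  have h := norm_image_sub_le_of_norm_deriv_le_segment' (a := 0) (b := t) (C := C)
    (fun r _ => (hd r).hasDerivWithinAt) (fun r hr => hC r ⟨hr.1, hr.2.le⟩) t ⟨ht, le_rfl⟩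
  simp only [zero_smul, NormedSpace.exp_zero, one_apply_eq_self, sub_zero] at h
  rwa [sub_right_comm]

end BoundedSemigroups

/-! ### Maximal dissipative operators and their resolvents -/

namespace LinearPMap

variable {H : Type*} [NormedAddCommGroup H] [InnerProductSpace ℝ H]

/-- A maximal dissipative operator: dissipative, and `α - A` is onto for every `α > 0`. -/
structure IsMaxDissipative (A : H →ₗ.[ℝ] H) : Prop where
  inner_nonpos : ∀ p ∈ A.graph, ⟪p.2, p.1⟫ ≤ 0
  exists_resolvent : ∀ α : ℝ, 0 < α → ∀ f : H, ∃ p ∈ A.graph, α • p.1 - p.2 = f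

namespace IsMaxDissipative

variable {A : H →ₗ.[ℝ] H}

theorem norm_le (hA : A.IsMaxDissipative) {α : ℝ} {p : H × H} (hp : p ∈ A.graph) :
    α * ‖p.1‖ ≤ ‖α • p.1 - p.2‖ := by
  rcases eq_or_ne p.1 0 with h0 | h0
  · simp [h0]
  have h := real_inner_le_norm (α • p.1 - p.2) p.1
  rw [inner_sub_left, real_inner_smul_left, real_inner_self_eq_norm_sq] at h
  have h1 := hA.inner_nonpos p hp
  have h2 : 0 < ‖p.1‖ := norm_pos_iff.2 h0
  refine le_of_mul_le_mul_right ?_ h2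
  nlinarith

/-- Dissipativity gives `α‖u‖ ≤ ‖αu - Au‖`, so the preimages provided by surjectivity are unique,
hence linear in `f`, and bounded. -/
theorem exists_resolventMap (hA : A.IsMaxDissipative) {α : ℝ} (hα : 0 < α) :
    ∃ R : H →L[ℝ] H, (∀ f, (R f, α • R f - f) ∈ A.graph) ∧ (∀ f, α * ‖R f‖ ≤ ‖f‖) ∧
      ∀ p ∈ A.graph, R (α • p.1 - p.2) = p.1 := by
  choose P hP hPf using hA.exists_resolvent α hα
  have huniq : ∀ p ∈ A.graph, ∀ q ∈ A.graph, α • p.1 - p.2 = α • q.1 - q.2 → p.1 = q.1 := by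
    intro p hp q hq h
    have h1 := hA.norm_le (α := α) (sub_mem hp hq)
    have h2 : α • (p - q).1 - (p - q).2 = 0 := by
      rw [Prod.fst_sub, Prod.snd_sub, smul_sub, sub_sub_sub_comm, h, sub_self]
    rw [h2, norm_zero] at h1
    have h3 : ‖(p - q).1‖ ≤ 0 := nonpos_of_mul_nonpos_right h1 hα
    exact sub_eq_zero.1 (norm_le_zero_iff.1 h3)
  have hbound : ∀ f, α * ‖(P f).1‖ ≤ ‖f‖ := fun f => by
    simpa only [hPf] using hA.norm_le (α := α) (hP f)
  let L : H →ₗ[ℝ] H :=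
    { toFun := fun f => (P f).1
      map_add' := fun f g => by
        refine huniq _ (hP _) _ (add_mem (hP f) (hP g)) ?_
        rw [hPf, Prod.fst_add, Prod.snd_add, smul_add, add_sub_add_comm, hPf, hPf]
      map_smul' := fun c f => by
        refine huniq _ (hP _) _ (Submodule.smul_mem _ c (hP f)) ?_
        rw [hPf, Prod.smul_fst, Prod.smul_snd, smul_comm, ← smul_sub, hPf] }
  refine ⟨L.mkContinuous α⁻¹ fun f => ?_, fun f => ?_, hbound, fun p hp => ?_⟩
  · rw [inv_mul_eq_div, le_div_iff₀ hα, mul_comm]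
    exact hbound f
  · have h : α • (P f).1 - f = (P f).2 := by
      nth_rewrite 2 [← hPf f]
      abel
    change ((P f).1, α • (P f).1 - f) ∈ A.graph
    rw [h]
    exact hP f
  · exact huniq _ (hP _) _ hp (hPf _)

/-- Write a vector `v` orthogonal to the domain as `u - Au`. Then `0 = ⟨u, v⟩ = ‖u‖² - ⟨u, Au⟩ ≥
‖u‖²`, which forces `u = 0` and `v = 0`. -/
theorem dense_domain [CompleteSpace H] (hA : A.IsMaxDissipative) : Dense (A.domain : Set H) := by
  rw [Submodule.dense_iff_topologicalClosure_eq_top, Submodule.topologicalClosure_eq_top_iff, Submodule.eq_bot_iff]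
  intro v hv
  obtain ⟨p, hp, hpv⟩ := hA.exists_resolvent 1 one_pos v
  have h1 : ⟪p.1, v⟫ = 0 :=
    (Submodule.mem_orthogonal _ _).1 hv _ (LinearPMap.mem_domain_iff.2 ⟨p.2, hp⟩)
  have h2 := hA.inner_nonpos p hp
  rw [← hpv, one_smul, inner_sub_right, real_inner_self_eq_norm_sq, real_inner_comm] at h1
  have h3 : p.1 = 0 := by
    have : ‖p.1‖ ^ 2 ≤ 0 := by linarith
    simpa using this
  have h4 : p.2 = 0 := A.graph_fst_eq_zero_snd (x := p.1) hp h3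
  rw [← hpv, h3, h4]
  simp

end IsMaxDissipative

end LinearPMap

/-! ### Convergence of contractions on a dense set -/

theorem cauchySeq_apply_of_dense {H : Type*} [NormedAddCommGroup H] [NormedSpace ℝ H]
    {L : ℕ → H →L[ℝ] H} (hL : ∀ n f, ‖L n f‖ ≤ ‖f‖) {D : Set H} (hD : Dense D)
    (h : ∀ f ∈ D, CauchySeq fun n => L n f) (f : H) : CauchySeq fun n => L n f := by
  rw [Metric.cauchySeq_iff']
  intro ε hε
  obtain ⟨g, hg, hfg⟩ := Metric.dense_iff.1 hD f (ε / 4) (by positivity)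
  obtain ⟨N, hN⟩ := Metric.cauchySeq_iff'.1 (h g hfg) (ε / 4) (by positivity)
  have hb : ∀ n, dist (L n f) (L n g) < ε / 4 := fun n => by
    rw [dist_eq_norm, ← map_sub]
    refine lt_of_le_of_lt (hL n _) ?_
    rwa [Metric.mem_ball, dist_comm, dist_eq_norm] at hg
  refine ⟨N, fun n hn => ?_⟩
  have h1 := hN n hn
  have h2 := hb n
  have h3 := hb N
  rw [dist_comm] at h3
  have h4 := dist_triangle4 (L n f) (L n g) (L N g) (L N f)
  linarith

theorem tendsto_apply_of_dense {H : Type*} [NormedAddCommGroup H] [NormedSpace ℝ H]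
    {L : ℕ → H →L[ℝ] H} (hL : ∀ n f, ‖L n f‖ ≤ ‖f‖) {D : Set H} (hD : Dense D)
    (h : ∀ f ∈ D, Tendsto (fun n => L n f) atTop (𝓝 f)) (f : H) :
    Tendsto (fun n => L n f) atTop (𝓝 f) := by
  rw [Metric.tendsto_atTop]
  intro ε hε
  obtain ⟨g, hg, hfg⟩ := Metric.dense_iff.1 hD f (ε / 4) (by positivity)
  obtain ⟨N, hN⟩ := Metric.tendsto_atTop.1 (h g hfg) (ε / 4) (by positivity)
  rw [Metric.mem_ball, dist_comm] at hg
  refine ⟨N, fun n hn => ?_⟩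
  have h1 := hN n hn
  have h2 : dist (L n f) (L n g) ≤ dist f g := by
    rw [dist_eq_norm, ← map_sub, dist_eq_norm]
    exact hL n _
  have h4 := dist_triangle4 (L n f) (L n g) g f
  rw [dist_comm g f] at h4
  linarith

/-! ### Yosida approximation and the Lumer–Phillips theorem -/

namespace LinearPMap.IsMaxDissipative

variable {H : Type*} [NormedAddCommGroup H] [InnerProductSpace ℝ H] [CompleteSpace H]
  {A : H →ₗ.[ℝ] H}

/-- Yosida approximation: bounded, commuting, dissipative operators converging to `A`. -/
theorem exists_yosida (hA : A.IsMaxDissipative) :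
    ∃ Y : ℕ → H →L[ℝ] H, (∀ n f, ⟪Y n f, f⟫ ≤ 0) ∧ (∀ n m, Commute (Y n) (Y m)) ∧
      (∀ p ∈ A.graph, Tendsto (fun n => Y n p.1) atTop (𝓝 p.2)) ∧
      ∀ p ∈ A.graph, ∀ n, ‖Y n p.1‖ ≤ ‖p.2‖ := by
  have ha : ∀ n : ℕ, (0 : ℝ) < n + 1 := fun n => by positivity
  choose R hRg hRb hRinv using fun n : ℕ => hA.exists_resolventMap (ha n)
  have hYp : ∀ p ∈ A.graph, ∀ n : ℕ, ((n : ℝ) + 1) • R n p.1 - p.1 = R n p.2 := by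
    intro p hp n
    have h := hRinv n p hp
    rw [_root_.map_sub, _root_.map_smul] at h
    nth_rewrite 2 [← h]
    abel
  have hcontr : ∀ (n : ℕ) f, ‖(((n : ℝ) + 1) • R n) f‖ ≤ ‖f‖ := fun n f => by
    rw [_root_.smul_apply, norm_smul, Real.norm_of_nonneg (ha n).le]
    exact hRb n f
  have hlim : ∀ f, Tendsto (fun n : ℕ => (((n : ℝ) + 1) • R n) f) atTop (𝓝 f) := by
    refine tendsto_apply_of_dense hcontr hA.dense_domain fun f hf => ?_
    obtain ⟨g, hg⟩ := LinearPMap.mem_domain_iff.1 hf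
    rw [tendsto_iff_norm_sub_tendsto_zero]
    have h0 : Tendsto (fun n : ℕ => ‖g‖ * (1 / ((n : ℝ) + 1))) atTop (𝓝 0) := by
      simpa using tendsto_one_div_add_atTop_nhds_zero_nat.const_mul ‖g‖
    refine squeeze_zero (fun _ => norm_nonneg _) (fun n => ?_) h0
    rw [_root_.smul_apply, hYp _ hg n, mul_one_div, le_div_iff₀ (ha n), mul_comm]
    exact hRb n g
  have hRcomm : ∀ n m, Commute (R n) (R m) := by
    -- The resolvent identity; exchanging `n` and `m` in it gives commutativity.
    have key : ∀ n m : ℕ, ∀ f, ((n : ℝ) - m) • R n (R m f) = R m f - R n f := by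
      intro n m f
      have h := hRinv n _ (hRg m f)
      rw [show ((n : ℝ) + 1) • R m f - (((m : ℝ) + 1) • R m f - f) = ((n : ℝ) - m) • R m f + f by
        module, _root_.map_add, _root_.map_smul] at h
      exact eq_sub_of_add_eq h
    intro n m
    rcases eq_or_ne n m with rfl | hnm
    · exact Commute.refl _
    ext f
    have h1 := key n m f
    have h2 := key m n f
    have h3 : ((n : ℝ) - m) • (R n (R m f) - R m (R n f)) = 0 := by
      rw [smul_sub, h1, ← neg_sub (m : ℝ) n, neg_smul, h2]
      abel
    have h4 : (n : ℝ) - m ≠ 0 := sub_ne_zero.2 (by exact_mod_cast hnm)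
    exact sub_eq_zero.1 ((smul_eq_zero.1 h3).resolve_left h4)
  -- With `α = n + 1` this is `α(αR - 1)`, which equals `αRA` on the domain of `A`; since `αR` tends
  -- strongly to the identity, it converges to `A` there.
  refine ⟨fun n => ((n : ℝ) + 1) • (((n : ℝ) + 1) • R n - 1), fun n f => ?_, fun n m => ?_,
    fun p hp => ?_, fun p hp n => ?_⟩
  · rw [_root_.smul_apply, real_inner_smul_left, _root_.sub_apply,
      inner_sub_left, one_apply_eq_self, real_inner_self_eq_norm_sq]
    have h1 := real_inner_le_norm ((((n : ℝ) + 1) • R n) f) f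
    have h2 := mul_le_mul_of_nonneg_right (hcontr n f) (norm_nonneg f)
    exact mul_nonpos_of_nonneg_of_nonpos (ha n).le (by nlinarith)
  · have h : ∀ n m : ℕ, Commute (((n : ℝ) + 1) • R n - 1) (((m : ℝ) + 1) • R m - 1) := fun n m =>
      ((((hRcomm n m).smul_left _).smul_right _).sub_right (Commute.one_right _)).sub_left
        (Commute.one_left _)
    exact ((h n m).smul_left _).smul_right _
  · refine (hlim p.2).congr fun n => ?_
    rw [_root_.smul_apply, _root_.smul_apply,
      _root_.sub_apply, _root_.smul_apply, one_apply_eq_self, hYp p hp]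
  · have h := hcontr n p.2
    rwa [_root_.smul_apply, ← hYp p hp] at h

/-- The exponentials of the Yosida approximants form a Cauchy sequence on the dense domain, hence
everywhere by contractivity. Their strong limit is the semigroup. -/
theorem exists_contraction_semigroup (hA : A.IsMaxDissipative) :
    ∃ T : C0Semigroup H, (∀ t f, ‖T t f‖ ≤ ‖f‖) ∧ A.graph ≤ T.generatorGraph := by
  obtain ⟨Y, hY, hcomm, hYlim, hYle⟩ := hA.exists_yosida
  let S : ℕ → ℝ≥0 → H →L[ℝ] H := fun n t => NormedSpace.exp ((t : ℝ) • Y n)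
  have hS : ∀ n t f, ‖S n t f‖ ≤ ‖f‖ := fun n t f => norm_exp_smul_apply_le (hY n) f t.coe_nonneg
  have hcau : ∀ t f, CauchySeq fun n => S n t f := by
    intro t
    refine cauchySeq_apply_of_dense (fun n => hS n t) hA.dense_domain fun f hf => ?_
    obtain ⟨g, hg⟩ := LinearPMap.mem_domain_iff.1 hf
    have hc := (hYlim _ hg).cauchySeq
    rw [Metric.cauchySeq_iff'] at hc ⊢
    intro ε hε
    obtain ⟨N, hN⟩ := hc (ε / (t + 1)) (by positivity)
    refine ⟨N, fun n hn => ?_⟩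
    have h1 := norm_exp_smul_apply_sub_le (hY n) (hY N) (hcomm n N) f t.coe_nonneg
    have h2 := hN n hn
    rw [dist_eq_norm] at h2 ⊢
    have ht : (0 : ℝ) < t + 1 := by positivity
    rw [lt_div_iff₀ ht] at h2
    refine lt_of_le_of_lt h1 ?_
    change ‖Y n f - Y N f‖ * _ < ε at h2
    nlinarith [norm_nonneg (Y n f - Y N f)]
  choose F hF using fun t f => cauchySeq_tendsto_of_complete (hcau t f)
  have hFle : ∀ t f, ‖F t f‖ ≤ ‖f‖ := fun t f =>
    le_of_tendsto (hF t f).norm (Eventually.of_forall fun n => hS n t f)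
  let L : ℝ≥0 → H →L[ℝ] H := fun t => LinearMap.mkContinuous
    { toFun := F t
      map_add' := fun f g => tendsto_nhds_unique (hF t (f + g)) <| by
        simpa only [_root_.map_add] using (hF t f).add (hF t g)
      map_smul' := fun c f => tendsto_nhds_unique (hF t (c • f)) <| by
        simpa only [_root_.map_smul, RingHom.id_apply] using (hF t f).const_smul c } 1 fun f => by
          rw [one_mul]
          exact hFle t f
  have hLle : ∀ t f, ‖L t f‖ ≤ ‖f‖ := hFle
  have hL : ∀ t f, Tendsto (fun n => S n t f) atTop (𝓝 (L t f)) := hF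
  have hzero : L 0 = ContinuousLinearMap.id ℝ H := by
    ext f
    refine tendsto_nhds_unique (hL 0 f) ?_
    simp [S, NormedSpace.exp_zero]
  have hadd : ∀ s t, L (s + t) = (L s).comp (L t) := by
    intro s t
    ext f
    refine tendsto_nhds_unique (hL (s + t) f) ?_
    have h1 : ∀ n, S n (s + t) f = S n s (S n t f - L t f) + S n s (L t f) := fun n => by
      have h2 : NormedSpace.exp (((s + t : ℝ≥0) : ℝ) • Y n) =
          NormedSpace.exp ((s : ℝ) • Y n) * NormedSpace.exp ((t : ℝ) • Y n) := by
        rw [NNReal.coe_add, add_smul]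
        let _ : NormedAlgebra ℚ (H →L[ℝ] H) := NormedAlgebra.restrictScalars ℚ ℝ _
        exact NormedSpace.exp_add_of_commute
          (((Commute.refl (Y n)).smul_left _).smul_right _)
      rw [← _root_.map_add, sub_add_cancel]
      exact DFunLike.congr_fun h2 f
    have h3 : Tendsto (fun n => S n s (S n t f - L t f)) atTop (𝓝 0) :=
      squeeze_zero_norm (fun n => hS n s _) (tendsto_iff_norm_sub_tendsto_zero.1 (hL t f))
    simpa only [h1, zero_add] using! h3.add (hL s (L t f))
  have hsub : ∀ s t f, s ≤ t → ‖L t f - L s f‖ ≤ ‖L (t - s) f - f‖ := by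
    intro s t f hst
    have h : L t f - L s f = L s (L (t - s) f - f) := by
      rw [_root_.map_sub, ← ContinuousLinearMap.comp_apply, ← hadd, add_tsub_cancel_of_le hst]
    rw [h]
    exact hLle s _
  have hself : ∀ p ∈ A.graph, ∀ t : ℝ≥0, ‖L t p.1 - p.1‖ ≤ t * ‖p.2‖ := fun p hp t =>
    le_of_tendsto ((hL t p.1).sub_const p.1).norm (Eventually.of_forall fun n =>
      (norm_exp_smul_apply_sub_self_le (hY n) p.1 t.coe_nonneg).trans
        (mul_le_mul_of_nonneg_left (hYle p hp n) t.coe_nonneg))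
  have hcontD : ∀ p ∈ A.graph, Continuous fun t => L t p.1 := by
    intro p hp
    refine (LipschitzWith.of_dist_le_mul (K := ‖p.2‖₊) fun s t => ?_).continuous
    wlog hst : t ≤ s generalizing s t
    · rw [dist_comm, dist_comm s t]
      exact this t s (le_of_not_ge hst)
    rw [dist_eq_norm]
    refine (hsub t s p.1 hst).trans ((hself p hp _).trans ?_)
    rw [mul_comm, coe_nnnorm, NNReal.dist_eq, NNReal.coe_sub hst]
    gcongr
    exact le_abs_self _
  have hcont : ∀ f, Continuous fun t => L t f := by
    intro f
    refine continuous_of_uniform_approx_of_continuous fun u hu => ?_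
    obtain ⟨ε, hε, hεu⟩ := Metric.mem_uniformity_dist.1 hu
    obtain ⟨g, hg, hgD⟩ := Metric.dense_iff.1 hA.dense_domain f ε hε
    obtain ⟨g', hg'⟩ := LinearPMap.mem_domain_iff.1 hgD
    refine ⟨_, hcontD _ hg', fun t => hεu ?_⟩
    rw [dist_eq_norm, ← _root_.map_sub]
    refine (hLle t _).trans_lt ?_
    rwa [← dist_eq_norm, dist_comm]
  refine ⟨⟨L, hzero, hadd, hcont⟩, hLle, fun p hp => ?_⟩
  change Tendsto (fun t : ℝ≥0 => (t : ℝ)⁻¹ • (L t p.1 - p.1)) (𝓝[>] 0) (𝓝 p.2)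
  rw [Metric.tendsto_nhds]
  intro ε hε
  -- The vector `p.2` need not lie in the domain, where `e^{rY}g - g` is small uniformly in `n`. It
  -- is therefore replaced by a nearby `g` that does.
  obtain ⟨g, hg, hgD⟩ := Metric.dense_iff.1 hA.dense_domain p.2 (ε / 8) (by positivity)
  obtain ⟨g', hg'⟩ := LinearPMap.mem_domain_iff.1 hgD
  rw [Metric.mem_ball, dist_eq_norm] at hg
  have hδ : (0 : ℝ≥0) < Real.toNNReal (ε / 8 / (‖g'‖ + 1)) := by
    rw [Real.toNNReal_pos]
    positivity
  filter_upwards [Ioo_mem_nhdsGT hδ] with t ht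
  have ht0 : (0 : ℝ) < t := ht.1
  have htδ : (t : ℝ) * (‖g'‖ + 1) < ε / 8 := by
    have h : (t : ℝ) < ε / 8 / (‖g'‖ + 1) := Real.lt_toNNReal_iff_coe_lt.1 ht.2
    rwa [lt_div_iff₀ (by positivity)] at h
  have key : ∀ n, ‖S n t p.1 - p.1 - (t : ℝ) • p.2‖ ≤ (‖Y n p.1 - p.2‖ + 3 * (ε / 8)) * t := by
    intro n
    refine norm_exp_smul_apply_sub_sub_le p.1 p.2 t.coe_nonneg fun r hr => ?_
    set E := NormedSpace.exp (r • Y n)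
    have hE : ∀ f, ‖E f‖ ≤ ‖f‖ := fun f => norm_exp_smul_apply_le (hY n) f hr.1
    have h1 : E (Y n p.1) - p.2 = E (Y n p.1 - p.2) - E (g - p.2) + (E g - g) + (g - p.2) := by
      simp only [_root_.map_sub]
      abel
    have h2 : ‖E g - g‖ ≤ ε / 8 := by
      refine (norm_exp_smul_apply_sub_self_le (hY n) g hr.1).trans ?_
      have h3 := hYle _ hg' n
      have h4 := mul_le_mul hr.2 h3 (norm_nonneg _) ht0.le
      nlinarith
    rw [h1]
    calc _ ≤ ‖E (Y n p.1 - p.2)‖ + ‖E (g - p.2)‖ + ‖E g - g‖ + ‖g - p.2‖ :=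
          (norm_add_le _ _).trans (add_le_add_left ((norm_add_le _ _).trans
            (add_le_add_left (norm_sub_le _ _) _)) _)
      _ ≤ _ := by linarith [hE (Y n p.1 - p.2), hE (g - p.2)]
  have hlim : ‖L t p.1 - p.1 - (t : ℝ) • p.2‖ ≤ (0 + 3 * (ε / 8)) * t := by
    refine le_of_tendsto_of_tendsto' ((((hL t p.1).sub_const p.1).sub_const _).norm) ?_ key
    exact ((tendsto_iff_norm_sub_tendsto_zero.1 (hYlim p hp)).add_const _).mul_const _
  have h5 : (t : ℝ)⁻¹ • (L t p.1 - p.1) - p.2 = (t : ℝ)⁻¹ • (L t p.1 - p.1 - (t : ℝ) • p.2) := by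
    rw [smul_sub _ _ ((t : ℝ) • p.2), inv_smul_smul₀ ht0.ne']
  rw [dist_eq_norm, h5, norm_smul, norm_inv, Real.norm_of_nonneg ht0.le, inv_mul_lt_iff₀ ht0]
  nlinarith

/-- The Lumer–Phillips theorem in Hilbert spaces. -/
theorem exists_generator_eq (hA : A.IsMaxDissipative) :
    ∃ T : C0Semigroup H, T.generator = A := by
  obtain ⟨T, hT, hAT⟩ := hA.exists_contraction_semigroup
  refine ⟨T, LinearPMap.eq_of_eq_graph ?_⟩
  rw [T.graph_generator]
  refine le_antisymm (fun p hp => ?_) hAT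
  -- The generator of a contraction semigroup is dissipative, so `1 - T.generator` is injective. As
  -- `1 - A` is already onto, the extension of `A` cannot be proper.
  have hdis : ∀ q ∈ T.generatorGraph, ⟪q.2, q.1⟫ ≤ 0 := by
    intro q hq
    have h : Tendsto (fun t : ℝ≥0 => ⟪(t : ℝ)⁻¹ • (T t q.1 - q.1), q.1⟫) (𝓝[>] 0)
        (𝓝 ⟪q.2, q.1⟫) := Tendsto.inner hq tendsto_const_nhds
    refine le_of_tendsto' h fun t => ?_
    rw [real_inner_smul_left, inner_sub_left, real_inner_self_eq_norm_sq]
    have h1 := real_inner_le_norm (T t q.1) q.1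
    have h2 := mul_le_mul_of_nonneg_right (hT t q.1) (norm_nonneg q.1)
    exact mul_nonpos_of_nonneg_of_nonpos (by positivity) (by nlinarith)
  obtain ⟨q, hq, hpq⟩ := hA.exists_resolvent 1 one_pos (p.1 - p.2)
  rw [one_smul] at hpq
  have hd := sub_mem hp (hAT hq)
  have h1 : (p - q).2 = (p - q).1 := by
    rw [Prod.snd_sub, Prod.fst_sub, sub_eq_sub_iff_sub_eq_sub, ← neg_sub p.1, ← hpq, neg_sub]
  have h2 := hdis _ hd
  rw [h1, real_inner_self_eq_norm_sq] at h2
  have h3 : (p - q).1 = 0 := by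
    have : ‖(p - q).1‖ ^ 2 = 0 := le_antisymm h2 (sq_nonneg _)
    simpa using this
  have h4 : p - q = 0 := Prod.ext h3 (h1.trans h3)
  rw [sub_eq_zero.1 h4]
  exact hq

end LinearPMap.IsMaxDissipative

theorem expSemigroup_generator {H : Type*} [NormedAddCommGroup H] [InnerProductSpace ℝ H]
    [CompleteSpace H] {A : H →ₗ.[ℝ] H} (hA : A.IsMaxDissipative) :
    (expSemigroup A).generator = A :=
  Classical.epsilon_spec hA.exists_generator_eq

/-! ### The form as a Hilbert space inner product; maximal dissipativity of the Laplacian -/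

namespace WeightedGraph

section Form

variable {V : Type*} (G : WeightedGraph V)

theorem form_self_nonneg (f : V → ℝ) : 0 ≤ G.form f f :=
  mul_nonneg (by norm_num) (tsum_nonneg fun p => by
    rw [mul_assoc]
    exact mul_nonneg (G.μ_nonneg _ _) (mul_self_nonneg _))

theorem form_comm (f g : V → ℝ) : G.form f g = G.form g f := by
  unfold form
  congr 1
  exact tsum_congr fun p => by ring

theorem energy_eq_ofReal_form {f : V → ℝ}
    (hf : Summable fun p : V × V => G.μ p.1 p.2 * (f p.1 - f p.2) ^ 2) :
    G.energy f = ENNReal.ofReal (G.form f f) := by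
  unfold energy form
  rw [ENNReal.ofReal_mul (by norm_num), ← ENNReal.ofReal_tsum_of_nonneg
    (fun p => mul_nonneg (G.μ_nonneg _ _) (sq_nonneg _)) hf, ENNReal.ofReal_inv_of_pos two_pos,
    ENNReal.ofReal_ofNat]
  congr 3
  ext p
  ring

theorem form_linear_left {f g h : V → ℝ} (a b : ℝ) (hf : G.energy f ≠ ∞) (hg : G.energy g ≠ ∞)
    (hh : G.energy h ≠ ∞) :
    G.form (a • f + b • g) h = a * G.form f h + b * G.form g h := by
  unfold form
  rw [mul_left_comm a, mul_left_comm b, ← mul_add]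
  congr 1
  rw [← (G.summable_form hf hh).tsum_mul_left, ← (G.summable_form hg hh).tsum_mul_left,
    ← ((G.summable_form hf hh).mul_left a).tsum_add ((G.summable_form hg hh).mul_left b)]
  refine tsum_congr fun p => ?_
  simp only [Pi.add_apply, Pi.smul_apply, smul_eq_mul]
  ring

/-- The weighted difference `√(μ x y / 2) * (f x - f y)` along an edge. -/
noncomputable def gradient (f : V → ℝ) (p : V × V) : ℝ :=
  √(G.μ p.1 p.2 / 2) * (f p.1 - f p.2)

theorem gradient_mul_gradient (f g : V → ℝ) (p : V × V) :
    G.gradient f p * G.gradient g p =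
      2⁻¹ * (G.μ p.1 p.2 * (f p.1 - f p.2) * (g p.1 - g p.2)) := by
  unfold gradient
  have h := Real.mul_self_sqrt (div_nonneg (G.μ_nonneg p.1 p.2) zero_le_two)
  linear_combination (f p.1 - f p.2) * (g p.1 - g p.2) * h

theorem memℓp_gradient {f : V → ℝ} (hf : G.energy f ≠ ∞) (c : ℝ) :
    Memℓp (fun p => c * G.gradient f p) 2 := by
  refine memℓp_gen ?_
  refine (((G.summable_of_energy_ne_top hf).mul_left 2⁻¹).mul_left (c ^ 2)).congr fun p => ?_
  rw [ENNReal.toReal_ofNat, Real.rpow_ofNat, Real.norm_eq_abs, sq_abs, mul_pow, pow_two (G.gradient f p),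
    gradient_mul_gradient]
  ring

theorem inner_gradient {f g : V → ℝ} {c : ℝ} {F F' : lp (fun _ : V × V => ℝ) 2}
    (hF : ∀ p, F p = c * G.gradient f p) (hF' : ∀ p, F' p = c * G.gradient g p) :
    ⟪F, F'⟫ = c ^ 2 * G.form f g := by
  rw [lp.inner_eq_tsum, form, ← tsum_mul_left, ← tsum_mul_left]
  refine tsum_congr fun p => ?_
  rw [hF, hF', ← gradient_mul_gradient]
  simp only [RCLike.inner_apply, conj_trivial]
  ring

/-- Finiteness of the energy is part of the conclusion: it comes from `F` lying in `ℓ²(V × V)`. -/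
theorem energy_eq_of_gradient {f : V → ℝ} {c : ℝ} (hc : c ≠ 0) {F : lp (fun _ : V × V => ℝ) 2}
    (hF : ∀ p, F p = c * G.gradient f p) : G.energy f = ENNReal.ofReal ((c ^ 2)⁻¹ * ‖F‖ ^ 2) := by
  have hs : Summable fun p : V × V => G.μ p.1 p.2 * (f p.1 - f p.2) ^ 2 := by
    have h := (memℓp_gen_iff (by norm_num)).1 (lp.memℓp F)
    refine (h.mul_left (2 * (c ^ 2)⁻¹)).congr fun p => ?_
    rw [ENNReal.toReal_ofNat, Real.rpow_ofNat, Real.norm_eq_abs, sq_abs, hF, mul_pow, pow_two (G.gradient f p),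
      gradient_mul_gradient]
    field_simp
  rw [G.energy_eq_ofReal_form hs, ← real_inner_self_eq_norm_sq, G.inner_gradient hF hF,
    inv_mul_cancel_left₀ (pow_ne_zero 2 hc)]

end Form

section Ell2

variable {V : Type*} [MeasurableSpace V] [DiscreteMeasurableSpace V] (G : WeightedGraph V)

theorem coe_sub (u v : G.ell2) : ⇑(u - v) = ⇑u - ⇑v :=
  funext (G.forall_of_ae (Lp.coeFn_sub u v))

theorem hasSum_inner (u v : G.ell2) : HasSum (fun x => G.m x * (u x * v x)) ⟪u, v⟫ := by
  rw [L2.inner_def]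
  have h := hasSum_integral_measure (μ := fun x => ENNReal.ofReal (G.m x) • Measure.dirac x)
    (L2.integrable_inner (𝕜 := ℝ) u v)
  refine h.congr_fun ?_
  intro x
  rw [integral_smul_measure, integral_dirac, ENNReal.toReal_ofReal (G.m_pos x).le]
  simp [mul_comm]

theorem hasSum_norm_sq (u : G.ell2) : HasSum (fun x => G.m x * u x ^ 2) (‖u‖ ^ 2) := by
  simpa only [← pow_two, real_inner_self_eq_norm_sq] using G.hasSum_inner u u

theorem tendsto_apply {ι : Type*} {l : Filter ι} {φ : ι → G.ell2} {u : G.ell2}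
    (h : Tendsto φ l (𝓝 u)) (x : V) : Tendsto (fun n => φ n x) l (𝓝 (u x)) := by
  have h1 : Tendsto (fun n => (G.m x)⁻¹ * ‖φ n - u‖ ^ 2) l (𝓝 0) := by
    simpa using ((tendsto_iff_norm_sub_tendsto_zero.1 h).pow 2).const_mul (G.m x)⁻¹
  have h2 : Tendsto (fun n => (φ n x - u x) ^ 2) l (𝓝 0) := by
    refine squeeze_zero (fun _ => sq_nonneg _) (fun n => ?_) h1
    have h3 := le_hasSum (G.hasSum_norm_sq (φ n - u)) x fun y _ =>
      mul_nonneg (G.m_pos y).le (sq_nonneg _)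
    rw [coe_sub, Pi.sub_apply] at h3
    rwa [inv_mul_eq_div, le_div_iff₀ (G.m_pos x), mul_comm]
  have h4 : Tendsto (fun n => |φ n x - u x|) l (𝓝 0) := by
    simpa [Real.sqrt_sq_eq_abs] using h2.sqrt
  exact tendsto_iff_norm_sub_tendsto_zero.2 h4

theorem exists_mul [Countable V] {w : V → ℝ} {C : ℝ} (hw : ∀ x, |w x| ≤ C) :
    ∃ M : G.ell2 →L[ℝ] G.ell2, ∀ u, ⇑(M u) = w * ⇑u := by
  have hm : ∀ u : G.ell2, MemLp (w * ⇑u) 2 G.measure := fun u =>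
    (Lp.memLp u).of_le_mul StronglyMeasurable.of_discrete.aestronglyMeasurable
      (c := C) (Eventually.of_forall fun x => by
        rw [Pi.mul_apply, norm_mul]
        exact mul_le_mul_of_nonneg_right (hw x) (norm_nonneg _))
  have hc : ∀ u : G.ell2, ⇑((hm u).toLp _) = w * ⇑u := fun u =>
    funext (G.forall_of_ae (hm u).coeFn_toLp)
  let M : G.ell2 →ₗ[ℝ] G.ell2 :=
    { toFun := fun u => (hm u).toLp _
      map_add' := fun u v => Lp.ext (Eventually.of_forall fun x => by
        rw [hc, coe_add, coe_add, Pi.add_apply, hc, hc]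
        exact mul_add _ _ _)
      map_smul' := fun c u => Lp.ext (Eventually.of_forall fun x => by
        rw [hc, coe_smul, coe_smul, Pi.smul_apply, hc]
        exact mul_left_comm _ _ _) }
  refine ⟨M.mkContinuous C fun u => ?_, hc⟩
  refine Lp.norm_le_mul_norm_of_ae_le_mul (Eventually.of_forall fun x => ?_)
  change ‖((hm u).toLp _) x‖ ≤ _
  rw [hc, Pi.mul_apply, norm_mul]
  exact mul_le_mul_of_nonneg_right (hw x) (norm_nonneg _)

/-- The weak equation is `α⟨u, v⟩ + Q(u, v) = ⟨f, v⟩` for all `v` in the form domain. Dividing by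
`α` and setting `c² = 1/α`, it says that `(u, c∇u)` is the orthogonal projection of `(α⁻¹f, 0)` onto
the closed space of pairs `(v, c∇v)` in `ℓ²_m ⊕ ℓ²(V × V)`. -/
theorem exists_resolvent_laplacian {α : ℝ} (hα : 0 < α) (f : G.ell2) :
    ∃ p ∈ G.laplacianGraph, α • p.1 - p.2 = f := by
  set c : ℝ := √α⁻¹ with hcdef
  have hc : c ≠ 0 := (Real.sqrt_pos.2 (inv_pos.2 hα)).ne'
  have hc2 : c ^ 2 = α⁻¹ := Real.sq_sqrt (inv_pos.2 hα).le
  let E := WithLp 2 (G.ell2 × lp (fun _ : V × V => ℝ) 2)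
  let K₀ : Submodule ℝ E :=
    { carrier := {e | (Function.support e.fst).Finite ∧ ∀ p, e.snd p = c * G.gradient e.fst p}
      add_mem' := by
        rintro a b ⟨ha, ha'⟩ ⟨hb, hb'⟩
        refine ⟨?_, fun p => ?_⟩
        · rw [WithLp.add_fst, coe_add]
          exact (ha.union hb).subset (Function.support_add _ _)
        · rw [WithLp.add_snd, lp.coeFn_add, Pi.add_apply, ha', hb', WithLp.add_fst, coe_add]
          simp only [gradient, Pi.add_apply]
          ring
      zero_mem' := by
        refine ⟨?_, fun p => ?_⟩
        · rw [WithLp.zero_fst, coe_zero]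
          simp
        · rw [WithLp.zero_snd, WithLp.zero_fst, coe_zero]
          simp [gradient]
      smul_mem' := by
        rintro k a ⟨ha, ha'⟩
        refine ⟨?_, fun p => ?_⟩
        · rw [WithLp.smul_fst, coe_smul]
          exact ha.subset (Function.support_const_smul_subset k _)
        · rw [WithLp.smul_snd, lp.coeFn_smul, Pi.smul_apply, ha', WithLp.smul_fst, coe_smul]
          simp only [gradient, Pi.smul_apply, smul_eq_mul]
          ring }
  -- Norm limits are pointwise limits, so the second component remains the gradient of the first;
  -- norm convergence in the second component is energy convergence.
  have hK : ∀ e ∈ K₀.topologicalClosure,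
      e.fst ∈ G.formDomain ∧ ∀ p, e.snd p = c * G.gradient e.fst p := by
    intro e he
    obtain ⟨a, ha, hlim⟩ := mem_closure_iff_seq_limit.1 he
    have hlim' := ((WithLp.prod_continuous_ofLp 2 _ _).tendsto _).comp hlim
    have h1 : Tendsto (fun n => (a n).fst) atTop (𝓝 e.fst) :=
      (continuous_fst.tendsto _).comp hlim'
    have h2 : Tendsto (fun n => (a n).snd) atTop (𝓝 e.snd) :=
      (continuous_snd.tendsto _).comp hlim'
    have h3 : ∀ p, e.snd p = c * G.gradient e.fst p := by
      intro p
      have h4 : Tendsto (fun n => (a n).snd p) atTop (𝓝 (e.snd p)) :=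
        ((lp.evalCLM ℝ (fun _ : V × V => ℝ) 2 p).continuous.tendsto _).comp h2
      refine tendsto_nhds_unique h4 ?_
      simp only [(ha _).2]
      exact (((G.tendsto_apply h1 p.1).sub (G.tendsto_apply h1 p.2)).const_mul _).const_mul _
    refine ⟨⟨fun n => (a n).fst, fun n => (ha n).1, h1, ?_⟩, h3⟩
    have h5 : ∀ n, G.energy (⇑e.fst - ⇑(a n).fst) =
        ENNReal.ofReal ((c ^ 2)⁻¹ * ‖e.snd - (a n).snd‖ ^ 2) := fun n => by
      refine G.energy_eq_of_gradient hc fun p => ?_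
      rw [lp.coeFn_sub, Pi.sub_apply, h3, (ha n).2]
      simp only [gradient, Pi.sub_apply]
      ring
    simp only [h5]
    rw [← ENNReal.ofReal_zero]
    refine (ENNReal.continuous_ofReal.tendsto _).comp ?_
    have h6 := ((tendsto_iff_norm_sub_tendsto_zero.1 h2).pow 2).const_mul (c ^ 2)⁻¹
    simpa [norm_sub_rev] using h6
  -- Conversely, every element of the form domain occurs, so orthogonality can be tested against all
  -- of them.
  have hK' : ∀ v ∈ G.formDomain, ∃ e ∈ K₀.topologicalClosure, e.fst = v := by
    intro v hv
    let gr : ∀ u : G.ell2, G.energy u ≠ ∞ → lp (fun _ : V × V => ℝ) 2 := fun u hu =>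
      ⟨_, G.memℓp_gradient hu c⟩
    have hgr : ∀ u hu p, gr u hu p = c * G.gradient u p := fun _ _ _ => rfl
    obtain ⟨φ, hφ, hφv, hφe⟩ := id hv
    have hv' := G.energy_ne_top hv
    have hφ' := fun n => G.energy_ne_top_of_finite _ (hφ n)
    refine ⟨WithLp.toLp 2 (v, gr v hv'), mem_closure_iff_seq_limit.2
      ⟨fun n => WithLp.toLp 2 (φ n, gr (φ n) (hφ' n)), fun n => ⟨hφ n, fun p => rfl⟩, ?_⟩, rfl⟩
    refine ((WithLp.prod_continuous_toLp 2 _ _).tendsto _).comp (hφv.prodMk_nhds ?_)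
    rw [tendsto_iff_norm_sub_tendsto_zero]
    have h5 : ∀ n, G.energy (⇑v - ⇑(φ n)) =
        ENNReal.ofReal ((c ^ 2)⁻¹ * ‖gr (φ n) (hφ' n) - gr v hv'‖ ^ 2) := fun n => by
      rw [norm_sub_rev]
      refine G.energy_eq_of_gradient hc fun p => ?_
      rw [lp.coeFn_sub, Pi.sub_apply, hgr _ hv', hgr _ (hφ' n)]
      simp only [gradient, Pi.sub_apply]
      ring
    simp only [h5] at hφe
    have h6 := ((ENNReal.continuousAt_toReal ENNReal.zero_ne_top).tendsto.comp hφe).const_mul (c ^ 2)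
    have h7 : ∀ n, c ^ 2 * (ENNReal.ofReal ((c ^ 2)⁻¹ * ‖gr (φ n) (hφ' n) - gr v hv'‖ ^ 2)).toReal
        = ‖gr (φ n) (hφ' n) - gr v hv'‖ ^ 2 := fun n => by
      rw [ENNReal.toReal_ofReal (by positivity), mul_inv_cancel_left₀ (pow_ne_zero 2 hc)]
    simp only [Function.comp_def, h7, ENNReal.toReal_zero, mul_zero] at h6
    simpa using h6.sqrt
  set K := K₀.topologicalClosure with hKdef
  have : CompleteSpace K := K₀.isClosed_topologicalClosure.completeSpace_coe
  let e₀ : E := WithLp.toLp 2 (α⁻¹ • f, 0)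
  obtain ⟨hu, hu'⟩ := hK _ (K.starProjection_apply_mem e₀)
  refine ⟨((K.starProjection e₀).fst, α • (K.starProjection e₀).fst - f),
    ⟨hu, fun v hv => ?_⟩, sub_sub_cancel _ _⟩
  obtain ⟨e, he, rfl⟩ := hK' v hv
  have h1 := K.starProjection_inner_eq_zero e₀ e he
  rw [inner_sub_left, sub_eq_zero, WithLp.prod_inner_apply, WithLp.prod_inner_apply] at h1
  have h2 := G.inner_gradient hu' (hK e he).2
  change ⟪α⁻¹ • f, e.fst⟫ + ⟪(0 : lp (fun _ : V × V => ℝ) 2), e.snd⟫ =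
    ⟪(K.starProjection e₀).fst, e.fst⟫ + ⟪(K.starProjection e₀).snd, e.snd⟫ at h1
  rw [h2, inner_zero_left, real_inner_smul_left, hc2] at h1
  rw [inner_sub_left, real_inner_smul_left]
  field_simp at h1
  linarith

theorem isMaxDissipative_laplacian : G.laplacian.IsMaxDissipative where
  inner_nonpos := by
    rw [graph_laplacian]
    intro p hp
    have h := hp.2 p.1 hp.1
    linarith [G.form_self_nonneg p.1]
  exists_resolvent α hα f := by
    rw [graph_laplacian]
    exact G.exists_resolvent_laplacian hα f

end Ell2

end WeightedGraph

/-! ### The Poincaré inequality from the spectrum -/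

namespace WeightedGraph

variable {V : Type*} [MeasurableSpace V] [DiscreteMeasurableSpace V] (G : WeightedGraph V)

theorem neg_mem_resolventSet {z : ℝ} (hz : z < 0) : z ∈ pmapResolventSet (-G.laplacian) := by
  obtain ⟨R, hRg, -, hRinv⟩ :=
    G.isMaxDissipative_laplacian.exists_resolventMap (neg_pos.2 hz)
  refine ⟨-R, fun f => ?_, fun u => ?_⟩
  · obtain ⟨u, hu, hu'⟩ := (LinearPMap.mem_graph_iff _).1 (neg_mem (hRg f))
    refine ⟨u, hu, ?_⟩
    rw [LinearPMap.neg_apply, hu, sub_neg_eq_add]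
    change z • (-(R f)) + G.laplacian u = f
    rw [hu']
    change z • (-(R f)) + -((-z) • R f - f) = f
    module
  · have h := hRinv _ (G.laplacian.mem_graph u)
    change -(R (z • (u : G.ell2) - -G.laplacian u)) = u
    rw [← map_neg]
    refine Eq.trans (congrArg R ?_) h
    module

/-- Poincaré's inequality with the bottom of the spectrum as constant. -/
theorem spectralBottom_mul_norm_sq_le {u : G.ell2} (hu : u ∈ G.formDomain) :
    G.spectralBottom * ‖u‖ ^ 2 ≤ G.form u u := by
  rcases eq_or_ne u 0 with h0 | h0
  · rw [h0, norm_zero]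
    simpa using G.form_self_nonneg (0 : G.ell2)
  -- The supremum `q` of the admissible Poincaré constants is shown to lie in the spectrum, whence
  -- `λ ≤ q`.
  set S : Set ℝ := {q | ∀ v ∈ G.formDomain, q * ‖v‖ ^ 2 ≤ G.form v v} with hS
  have hle : ∀ v ∈ G.formDomain, v ≠ 0 → ∀ q ∈ S, q ≤ G.form v v / ‖v‖ ^ 2 := by
    intro v hv hv0 q hq
    have h : 0 < ‖v‖ := norm_pos_iff.2 hv0
    rw [le_div_iff₀ (by positivity)]
    exact hq v hv
  have hbdd : BddAbove S := ⟨_, hle u hu h0⟩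
  have hne : S.Nonempty := ⟨0, fun v _ => by simpa using G.form_self_nonneg v⟩
  set q := sSup S with hq
  have hqS : ∀ v ∈ G.formDomain, q * ‖v‖ ^ 2 ≤ G.form v v := by
    intro v hv
    rcases eq_or_ne v 0 with hv0 | hv0
    · rw [hv0, norm_zero]
      simpa using G.form_self_nonneg (0 : G.ell2)
    · have h : 0 < ‖v‖ := norm_pos_iff.2 hv0
      rw [← le_div_iff₀ (by positivity)]
      exact csSup_le hne (hle v hv hv0)
  refine (mul_le_mul_of_nonneg_right ?_ (sq_nonneg _)).trans (hqS u hu)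
  have hbelow : BddBelow (pmapSpectrum (-G.laplacian)) :=
    ⟨0, fun z hz => not_lt.1 fun hz0 => hz (G.neg_mem_resolventSet hz0)⟩
  refine csInf_le hbelow fun hres => ?_
  obtain ⟨R, hR, -⟩ := hres
  have hRg : ∀ f, (R f, f - q • R f) ∈ G.laplacianGraph := by
    intro f
    obtain ⟨w, hw, hwf⟩ := hR f
    rw [← graph_laplacian, LinearPMap.mem_graph_iff]
    refine ⟨w, hw, ?_⟩
    rw [LinearPMap.neg_apply] at hwf
    change G.laplacian w = f - q • R f
    rw [← hw, eq_sub_iff_add_eq, add_comm]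
    rwa [sub_neg_eq_add] at hwf
  set k := ‖R‖ + 1 with hk
  have hk1 : 1 ≤ k := le_add_of_nonneg_left (norm_nonneg R)
  have hk0 : 0 < k := one_pos.trans_le hk1
  -- If `q` were in the resolvent set, the nonnegative form `a = Q - q⟨·,·⟩` would satisfy `a(Rv, w)
  -- = -⟨v, w⟩`. Evaluating `a ≥ 0` at `Rv + kv` gives `k²a(v, v) ≥ 2k‖v‖² + ⟨v, Rv⟩ ≥ k‖v‖²`, by
  -- the choice `k = ‖R‖ + 1`. So `q` could be increased by `1/k`.
  have hmem : q + k⁻¹ ∈ S := by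
    intro v hv
    obtain ⟨hRv, hRv'⟩ := hRg v
    have ht : R v + k • v ∈ G.formDomain := add_mem hRv (Submodule.smul_mem _ k hv)
    have h1 := hqS _ ht
    have h2 := hRv' _ ht
    have h3 := hRv' v hv
    have hev := G.energy_ne_top hv
    have heR := G.energy_ne_top hRv
    have het := G.energy_ne_top ht
    have hc : ⇑(R v + k • v) = (1 : ℝ) • ⇑(R v) + k • ⇑v := by
      rw [coe_add, coe_smul, one_smul]
    have h4 : G.form ⇑(R v + k • v) ⇑(R v + k • v) =
        1 * G.form (R v) ⇑(R v + k • v) + k * G.form v ⇑(R v + k • v) := by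
      nth_rewrite 1 [hc]
      exact G.form_linear_left 1 k heR hev het
    have h5 : G.form v ⇑(R v + k • v) = 1 * G.form (R v) v + k * G.form v v := by
      rw [form_comm, hc]
      exact G.form_linear_left 1 k heR hev hev
    rw [← real_inner_self_eq_norm_sq] at h1
    simp only [inner_add_left, inner_add_right, inner_sub_left, real_inner_smul_left,
      real_inner_smul_right, real_inner_self_eq_norm_sq, norm_smul, mul_pow, Real.norm_eq_abs,
      sq_abs] at h1 h2 h3
    rw [real_inner_comm v (R v)] at *
    have h6 : -⟪v, R v⟫ ≤ ‖R‖ * ‖v‖ ^ 2 := by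
      have h7 := neg_le_of_abs_le (abs_real_inner_le_norm v (R v))
      have h8 := mul_le_mul_of_nonneg_left (R.le_opNorm v) (norm_nonneg v)
      nlinarith
    have h9 : k * ‖v‖ ^ 2 ≤ k * (k * (G.form v v - q * ‖v‖ ^ 2)) := by
      have h10 : 0 ≤ ‖v‖ ^ 2 := sq_nonneg _
      have h11 : ‖R‖ = k - 1 := by rw [hk]; ring
      rw [h11] at h6
      rw [h4, h5, h2, h3] at h1
      nlinarith
    have h12 := le_of_mul_le_mul_left h9 hk0
    rw [add_mul, inv_mul_eq_div]
    have h13 : ‖v‖ ^ 2 / k ≤ G.form v v - q * ‖v‖ ^ 2 := by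
      rw [div_le_iff₀ hk0]
      linarith
    linarith
  have := le_csSup hbdd hmem
  have : 0 < k⁻¹ := inv_pos.2 hk0
  linarith

end WeightedGraph

/-! ### Scalar inequalities for the exponential weights -/

/-- Compare power series: every term of `cosh - 1` has degree at least two, so it picks up a factor
at most `θ²`. -/
theorem cosh_mul_sub_one_le {θ : ℝ} (h0 : 0 ≤ θ) (h1 : θ ≤ 1) (y : ℝ) :
    Real.cosh (θ * y) - 1 ≤ θ ^ 2 * (Real.cosh y - 1) := by
  have h := hasSum_ite_eq (0 : ℕ) (1 : ℝ)
  refine hasSum_le (fun n => ?_) ((Real.hasSum_cosh (θ * y)).sub h)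
    (((Real.hasSum_cosh y).sub h).mul_left (θ ^ 2))
  rcases Nat.eq_zero_or_pos n with rfl | hn
  · simp
  · rw [if_neg hn.ne', sub_zero, sub_zero, mul_pow, mul_div_assoc]
    refine mul_le_mul_of_nonneg_right (pow_le_pow_of_le_one h0 h1 (by lia)) ?_
    have : 0 ≤ y ^ (2 * n) := Even.pow_nonneg (even_two_mul n) y
    positivity

/-- Turns the hyperbolic error along an edge of length `r ≤ s` into a multiple of `r²`, the quantity
that the intrinsic condition controls. -/
theorem cosh_sub_one_le_mul_sq {a r s κ : ℝ} (hs : 0 < s) (hr : 0 ≤ r) (hrs : r ≤ s)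
    (ha : |a| ≤ κ * r) :
    Real.cosh a - 1 ≤ (Real.cosh (κ * s) - 1) / s ^ 2 * r ^ 2 := by
  have h1 : Real.cosh a ≤ Real.cosh (κ * r) := by
    rw [Real.cosh_le_cosh]
    exact ha.trans (le_abs_self _)
  have h2 := cosh_mul_sub_one_le (div_nonneg hr hs.le) ((div_le_one hs).2 hrs) (κ * s)
  have h3 : r / s * (κ * s) = κ * r := by field_simp
  have h4 : (r / s) ^ 2 * (Real.cosh (κ * s) - 1) = (Real.cosh (κ * s) - 1) / s ^ 2 * r ^ 2 := by
    field_simp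
  rw [h3, h4] at h2
  linarith

theorem abs_exp_sub_exp_le {a b C : ℝ} (ha : a ≤ C) (hb : b ≤ C) :
    |Real.exp a - Real.exp b| ≤ Real.exp C * |a - b| := by
  have key : ∀ a b : ℝ, a ≤ C → Real.exp a - Real.exp b ≤ Real.exp C * |a - b| := by
    intro a b ha
    have h1 := Real.add_one_le_exp (b - a)
    have h2 : Real.exp b = Real.exp a * Real.exp (b - a) := by
      rw [← Real.exp_add, add_sub_cancel]
    have h3 : Real.exp a * |a - b| ≤ Real.exp C * |a - b| :=
      mul_le_mul_of_nonneg_right (Real.exp_le_exp.2 ha) (abs_nonneg _)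
    have h4 := mul_le_mul_of_nonneg_left (le_abs_self (a - b)) (Real.exp_pos a).le
    have h5 := mul_le_mul_of_nonneg_left h1 (Real.exp_pos a).le
    rw [h2]
    linarith
  rw [abs_le]
  have h := key b a hb
  rw [abs_sub_comm] at h
  exact ⟨by linarith, key a b ha⟩

/-! ### Multiplication by Lipschitz weights and the Davies estimate -/

namespace WeightedGraph

theorem le_of_adj_of_jumpSize_eq {V : Type*} {G : WeightedGraph V} {ρ : PseudoMetric V ℝ} {s : ℝ}
    (hs : 0 ≤ s) (hjump : G.jumpSize ρ = ENNReal.ofReal s) {x y : V} (h : G.Adj x y) :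
    ρ x y ≤ s := by
  rw [← ENNReal.ofReal_le_ofReal_iff hs, ← hjump]
  exact le_iSup_of_le x (le_iSup_of_le y (le_iSup_of_le h le_rfl))

variable {V : Type*} [MeasurableSpace V] [DiscreteMeasurableSpace V] {G : WeightedGraph V}

theorem inner_mul_comm {w : V → ℝ} {M : G.ell2 →L[ℝ] G.ell2} (hM : ∀ u, ⇑(M u) = w * ⇑u)
    (u v : G.ell2) : ⟪M u, v⟫ = ⟪u, M v⟫ := by
  refine (G.hasSum_inner (M u) v).unique ?_
  convert! G.hasSum_inner u (M v) using 2 with x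
  rw [hM, hM, Pi.mul_apply, Pi.mul_apply]
  ring

theorem IsIntrinsic.summable {ρ : PseudoMetric V ℝ} (hρ : G.IsIntrinsic ρ) (u : G.ell2) :
    Summable fun p : V × V => G.μ p.1 p.2 * ρ p.1 p.2 ^ 2 * u p.1 ^ 2 := by
  have h0 : ∀ x y, 0 ≤ G.μ x y * ρ x y ^ 2 := fun x y => mul_nonneg (G.μ_nonneg _ _) (sq_nonneg _)
  have h1 : 0 ≤ fun p : V × V => G.μ p.1 p.2 * ρ p.1 p.2 ^ 2 * u p.1 ^ 2 := fun p =>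
    mul_nonneg (h0 p.1 p.2) (sq_nonneg _)
  refine (summable_prod_of_nonneg h1).2 ⟨fun x => (hρ x).1.mul_right (u x ^ 2), ?_⟩
  refine Summable.of_nonneg_of_le (fun x => tsum_nonneg fun y => h1 (x, y))
    (fun x => ?_) (G.hasSum_norm_sq u).summable
  dsimp only
  rw [(hρ x).1.tsum_mul_right]
  exact mul_le_mul_of_nonneg_right (hρ x).2 (sq_nonneg _)

theorem IsIntrinsic.tsum_le {ρ : PseudoMetric V ℝ} (hρ : G.IsIntrinsic ρ) (u : G.ell2) :
    ∑' p : V × V, G.μ p.1 p.2 * ρ p.1 p.2 ^ 2 * u p.1 ^ 2 ≤ ‖u‖ ^ 2 := by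
  rw [(hρ.summable u).tsum_prod, ← (G.hasSum_norm_sq u).tsum_eq]
  refine (hρ.summable u).prod.tsum_le_tsum (fun x => ?_) (G.hasSum_norm_sq u).summable
  dsimp only
  rw [(hρ x).1.tsum_mul_right]
  exact mul_le_mul_of_nonneg_right (hρ x).2 (sq_nonneg _)

theorem IsIntrinsic.hasSum_swap {ρ : PseudoMetric V ℝ} (hρ : G.IsIntrinsic ρ) (u : G.ell2) :
    HasSum (fun p : V × V => G.μ p.1 p.2 * ρ p.1 p.2 ^ 2 * u p.2 ^ 2)
      (∑' p : V × V, G.μ p.1 p.2 * ρ p.1 p.2 ^ 2 * u p.1 ^ 2) := by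
  have h := (Equiv.prodComm V V).hasSum_iff.2 (hρ.summable u).hasSum
  convert! h using 2 with p
  simp [G.μ_symm p.1 p.2, ρ.symm p.1 p.2]

/-- Leibniz rule: `wu(x) - wu(y) = w(x)(u(x) - u(y)) + (w(x) - w(y))u(y)`. The second part is summed
using the Lipschitz bound and the intrinsic condition. -/
theorem IsIntrinsic.energy_mul_le {ρ : PseudoMetric V ℝ} (hρ : G.IsIntrinsic ρ) {w : V → ℝ}
    {C L : ℝ} (hw : ∀ x, |w x| ≤ C) (hL : ∀ x y, |w x - w y| ≤ L * ρ x y) (u : G.ell2) :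
    G.energy (w * ⇑u) ≤
      ENNReal.ofReal (2 * C ^ 2) * G.energy u + ENNReal.ofReal (L ^ 2 * ‖u‖ ^ 2) := by
  have hle : ∀ p : V × V, ENNReal.ofReal (G.μ p.1 p.2 * ((w * ⇑u) p.1 - (w * ⇑u) p.2) ^ 2) ≤
      ENNReal.ofReal (2 * C ^ 2) * ENNReal.ofReal (G.μ p.1 p.2 * (u p.1 - u p.2) ^ 2) +
      ENNReal.ofReal (2 * L ^ 2) * ENNReal.ofReal (G.μ p.1 p.2 * ρ p.1 p.2 ^ 2 * u p.2 ^ 2) := by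
    intro p
    have hμ := G.μ_nonneg p.1 p.2
    rw [← ENNReal.ofReal_mul (by positivity), ← ENNReal.ofReal_mul (by positivity),
      ← ENNReal.ofReal_add (by positivity) (by positivity)]
    refine ENNReal.ofReal_le_ofReal ?_
    have h1 : w p.1 ^ 2 ≤ C ^ 2 := sq_le_sq' (neg_le_of_abs_le (hw _)) (le_of_abs_le (hw _))
    have h2 : (w p.1 - w p.2) ^ 2 ≤ (L * ρ p.1 p.2) ^ 2 :=
      sq_le_sq' (neg_le_of_abs_le (hL _ _)) (le_of_abs_le (hL _ _))
    have h3 : ((w * ⇑u) p.1 - (w * ⇑u) p.2) ^ 2 ≤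
        2 * (w p.1 ^ 2 * (u p.1 - u p.2) ^ 2) + 2 * ((w p.1 - w p.2) ^ 2 * u p.2 ^ 2) := by
      simp only [Pi.mul_apply]
      nlinarith [sq_nonneg (w p.1 * (u p.1 - u p.2) - (w p.1 - w p.2) * u p.2)]
    have h4 := mul_le_mul_of_nonneg_right h1 (sq_nonneg (u p.1 - u p.2))
    have h5 := mul_le_mul_of_nonneg_right h2 (sq_nonneg (u p.2))
    calc _ ≤ G.μ p.1 p.2 * (2 * (C ^ 2 * (u p.1 - u p.2) ^ 2) +
          2 * ((L * ρ p.1 p.2) ^ 2 * u p.2 ^ 2)) := by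
          refine mul_le_mul_of_nonneg_left ?_ hμ
          linarith
      _ = _ := by ring
  have hsum : ∑' p : V × V, ENNReal.ofReal (G.μ p.1 p.2 * ρ p.1 p.2 ^ 2 * u p.2 ^ 2) ≤
      ENNReal.ofReal (‖u‖ ^ 2) := by
    rw [← ENNReal.ofReal_tsum_of_nonneg (fun p => mul_nonneg (mul_nonneg (G.μ_nonneg _ _)
      (sq_nonneg _)) (sq_nonneg _)) (hρ.hasSum_swap u).summable, (hρ.hasSum_swap u).tsum_eq]
    exact ENNReal.ofReal_le_ofReal (hρ.tsum_le u)
  unfold energy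
  calc _ ≤ 2⁻¹ * ∑' p : V × V, (ENNReal.ofReal (2 * C ^ 2) *
        ENNReal.ofReal (G.μ p.1 p.2 * (u p.1 - u p.2) ^ 2) + ENNReal.ofReal (2 * L ^ 2) *
        ENNReal.ofReal (G.μ p.1 p.2 * ρ p.1 p.2 ^ 2 * u p.2 ^ 2)) := by
        gcongr with p
        exact hle p
    _ ≤ 2⁻¹ * (ENNReal.ofReal (2 * C ^ 2) *
        (∑' p : V × V, ENNReal.ofReal (G.μ p.1 p.2 * (u p.1 - u p.2) ^ 2)) +
        ENNReal.ofReal (2 * L ^ 2) * ENNReal.ofReal (‖u‖ ^ 2)) := by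
        rw [ENNReal.tsum_add, ENNReal.tsum_mul_left, ENNReal.tsum_mul_left]
        gcongr
    _ = _ := by
        have h2 : ENNReal.ofReal (2 * L ^ 2) * ENNReal.ofReal (‖u‖ ^ 2) =
            2 * ENNReal.ofReal (L ^ 2 * ‖u‖ ^ 2) := by
          rw [← ENNReal.ofReal_mul (by positivity), mul_assoc 2, ENNReal.ofReal_mul zero_le_two,
            ENNReal.ofReal_ofNat]
        rw [mul_add, mul_left_comm, h2, ← mul_assoc 2⁻¹ 2,
          ENNReal.inv_mul_cancel two_ne_zero ENNReal.ofNat_ne_top, one_mul]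

/-- Makes `e^{2φ}u` an admissible test function. Multiplication preserves finite supports, and the
energy bound carries the approximating sequence over. -/
theorem IsIntrinsic.mul_mem_formDomain {ρ : PseudoMetric V ℝ} (hρ : G.IsIntrinsic ρ) {w : V → ℝ}
    {C L : ℝ} (hw : ∀ x, |w x| ≤ C) (hL : ∀ x y, |w x - w y| ≤ L * ρ x y)
    {M : G.ell2 →L[ℝ] G.ell2} (hM : ∀ u, ⇑(M u) = w * ⇑u) {u : G.ell2} (hu : u ∈ G.formDomain) :
    M u ∈ G.formDomain := by
  obtain ⟨φ, hφ, hφu, hφe⟩ := hu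
  refine ⟨fun n => M (φ n), fun n => ?_, (M.continuous.tendsto u).comp hφu, ?_⟩
  · rw [hM]
    exact (hφ n).subset (Function.support_mul_subset_right _ _)
  have h1 : ∀ n, G.energy (⇑(M u) - ⇑(M (φ n))) ≤ ENNReal.ofReal (2 * C ^ 2) *
      G.energy (⇑u - ⇑(φ n)) + ENNReal.ofReal (L ^ 2 * ‖u - φ n‖ ^ 2) := by
    intro n
    rw [← coe_sub, ← map_sub, hM, ← coe_sub]
    exact hρ.energy_mul_le hw hL _
  have h2 : Tendsto (fun n => ENNReal.ofReal (2 * C ^ 2) * G.energy (⇑u - ⇑(φ n)) +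
      ENNReal.ofReal (L ^ 2 * ‖u - φ n‖ ^ 2)) atTop (𝓝 0) := by
    have h3 := ENNReal.Tendsto.const_mul (a := ENNReal.ofReal (2 * C ^ 2)) hφe
      (Or.inr ENNReal.ofReal_ne_top)
    have h4 := ((tendsto_iff_norm_sub_tendsto_zero.1 hφu).pow 2).const_mul (L ^ 2)
    have h5 := (ENNReal.continuous_ofReal.tendsto _).comp h4
    simpa [Function.comp_def, norm_sub_rev] using h3.add h5
  exact tendsto_of_tendsto_of_tendsto_of_le_of_le tendsto_const_nhds h2 (fun _ => zero_le) h1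

/-- The Davies estimate `Q(u, e^{2φ} u) ≥ Q(e^φ u) - c ‖e^φ u‖²`. -/
theorem IsIntrinsic.form_exp_mul_ge {ρ : PseudoMetric V ℝ} (hρ : G.IsIntrinsic ρ) {s κ : ℝ}
    (hs : 0 < s) (hjump : ∀ x y, G.Adj x y → ρ x y ≤ s) {φ : V → ℝ}
    (hφ : ∀ x y, |φ x - φ y| ≤ κ * ρ x y) {u v v' : G.ell2}
    (hv : ∀ x, v x = Real.exp (φ x) * u x) (hv' : ∀ x, v' x = Real.exp (φ x) * v x)
    (hu_en : G.energy u ≠ ∞) (hv_en : G.energy v ≠ ∞) (hv'_en : G.energy v' ≠ ∞) :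
    G.form v v - (Real.cosh (κ * s) - 1) / s ^ 2 * ‖v‖ ^ 2 ≤ G.form u v' := by
  set c := (Real.cosh (κ * s) - 1) / s ^ 2 with hc
  have hc0 : 0 ≤ c := div_nonneg (sub_nonneg.2 (Real.one_le_cosh _)) (sq_nonneg _)
  set S := ∑' p : V × V, G.μ p.1 p.2 * ρ p.1 p.2 ^ 2 * v p.1 ^ 2 with hS
  have hsum : HasSum (fun p : V × V => G.μ p.1 p.2 * (v p.1 - v p.2) * (v p.1 - v p.2) -
      c * (G.μ p.1 p.2 * ρ p.1 p.2 ^ 2 * v p.1 ^ 2 + G.μ p.1 p.2 * ρ p.1 p.2 ^ 2 * v p.2 ^ 2))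
      (2 * G.form v v - c * (S + S)) := by
    have h1 := (G.summable_form hv_en hv_en).hasSum
    have h2 : ∑' p : V × V, G.μ p.1 p.2 * (v p.1 - v p.2) * (v p.1 - v p.2) = 2 * G.form v v := by
      rw [form, mul_inv_cancel_left₀ two_ne_zero]
    rw [h2] at h1
    exact h1.sub (((hρ.summable v).hasSum.add (hρ.hasSum_swap v)).mul_left c)
  have hsum' : HasSum (fun p : V × V => G.μ p.1 p.2 * (u p.1 - u p.2) * (v' p.1 - v' p.2))
      (2 * G.form u v') := by
    rw [form, mul_inv_cancel_left₀ two_ne_zero]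
    exact (G.summable_form hu_en hv'_en).hasSum
  have hle := hasSum_le (fun p => ?_) hsum hsum'
  · have h3 := mul_le_mul_of_nonneg_left (hρ.tsum_le v) hc0
    linarith
  obtain ⟨x, y⟩ := p
  dsimp only
  rcases (G.μ_nonneg x y).eq_or_lt with h0 | h0
  · simp [← h0]
  have hcosh := cosh_sub_one_le_mul_sq hs (ρ.nonneg x y) (hjump x y h0) (hφ x y)
  set D := Real.cosh (φ x - φ y) - 1 with hD
  have hD0 : 0 ≤ D := sub_nonneg.2 (Real.one_le_cosh _)
  -- Expand with `u = e^{-φ}v` and `v' = e^φ v`; the two cross terms combine into `2cosh(φ x - φ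
  -- y)`.
  have key : (u x - u y) * (v' x - v' y) = (v x - v y) ^ 2 - 2 * (v x * v y) * D := by
    have h1 : ∀ z, u z = Real.exp (-φ z) * v z := fun z => by
      rw [hv, ← mul_assoc, ← Real.exp_add, neg_add_cancel, Real.exp_zero, one_mul]
    have hxx : Real.exp (-φ x) * Real.exp (φ x) = 1 := by rw [← Real.exp_add]; simp
    have hyy : Real.exp (-φ y) * Real.exp (φ y) = 1 := by rw [← Real.exp_add]; simp
    have hxy : Real.exp (-φ x) * Real.exp (φ y) = Real.exp (-(φ x - φ y)) := by
      rw [← Real.exp_add]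
      congr 1
      ring
    have hyx : Real.exp (-φ y) * Real.exp (φ x) = Real.exp (φ x - φ y) := by
      rw [← Real.exp_add]
      congr 1
      ring
    rw [hD, Real.cosh_eq, hv', hv', h1 x, h1 y, ← hxy, ← hyx]
    linear_combination v x ^ 2 * hxx + v y ^ 2 * hyy
  have h6 : 2 * (v x * v y) * D ≤ (v x ^ 2 + v y ^ 2) * (c * ρ x y ^ 2) := by
    have h7 : 2 * (v x * v y) ≤ v x ^ 2 + v y ^ 2 := by nlinarith [sq_nonneg (v x - v y)]
    exact mul_le_mul h7 hcosh hD0 (by positivity)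
  have h8 := mul_le_mul_of_nonneg_left h6 h0.le
  have h9 : G.μ x y * (u x - u y) * (v' x - v' y) =
      G.μ x y * ((v x - v y) ^ 2 - 2 * (v x * v y) * D) := by rw [← key, mul_assoc]
  rw [h9]
  linarith

end WeightedGraph

/-! ### Growth of weighted norms along a semigroup -/

namespace C0Semigroup

variable {H : Type*} [NormedAddCommGroup H] [InnerProductSpace ℝ H] (T : C0Semigroup H)

theorem apply_mem_generatorGraph {p : H × H} (hp : p ∈ T.generatorGraph) (t : ℝ≥0) :
    (T t p.1, T t p.2) ∈ T.generatorGraph := by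
  refine (((T t).continuous.tendsto _).comp hp).congr fun r => ?_
  rw [Function.comp_apply, _root_.map_smul, _root_.map_sub]
  simp only [← ContinuousLinearMap.comp_apply, ← T.map_add, add_comm]

/-- The definition of the generator directly yields only the right derivative, which is enough for
Grönwall's inequality. -/
theorem hasDerivWithinAt_apply {p : H × H} (hp : p ∈ T.generatorGraph) {t : ℝ} (ht : 0 ≤ t) :
    HasDerivWithinAt (fun r : ℝ => T r.toNNReal p.1) (T t.toNNReal p.2) (Set.Ici t) t := by
  rw [hasDerivWithinAt_iff_tendsto_slope, Set.Ici_sdiff_left]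
  have h1 : Tendsto (fun r : ℝ => (r - t).toNNReal) (𝓝[>] t) (𝓝[>] 0) := by
    refine tendsto_nhdsWithin_iff.2 ⟨?_, ?_⟩
    · have h : Continuous fun r : ℝ => (r - t).toNNReal := by fun_prop
      have h2 := h.tendsto t
      simp only [sub_self, Real.toNNReal_zero] at h2
      exact h2.mono_left nhdsWithin_le_nhds
    · filter_upwards [self_mem_nhdsWithin] with r hr
      exact Real.toNNReal_pos.2 (sub_pos.2 hr)
  have h2 : Tendsto _ _ _ := Tendsto.comp (T.apply_mem_generatorGraph hp t.toNNReal) h1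
  refine h2.congr' ?_
  filter_upwards [self_mem_nhdsWithin] with r hr
  have hr' : 0 ≤ r - t := sub_nonneg.2 (le_of_lt hr)
  have h3 : r.toNNReal = (r - t).toNNReal + t.toNNReal := by
    rw [← Real.toNNReal_add hr' ht, sub_add_cancel]
  rw [Function.comp_apply, slope_def_module, Real.coe_toNNReal _ hr', h3, T.map_add]
  rfl

/-- If `⟪M u, M A u⟫ ≤ k ‖M u‖²` on the domain of the generator `A`, then
`‖M (T t f)‖ ≤ e^{kt} ‖M f‖`. -/
theorem norm_apply_le_exp_mul (M : H →L[ℝ] H) {k : ℝ}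
    (hdense : Dense (T.generator.domain : Set H))
    (hk : ∀ p ∈ T.generatorGraph, ⟪M p.1, M p.2⟫ ≤ k * ‖M p.1‖ ^ 2) (t : ℝ≥0) (f : H) :
    ‖M (T t f)‖ ≤ Real.exp (k * t) * ‖M f‖ := by
  have hclosed : IsClosed {f : H | ‖M (T t f)‖ ≤ Real.exp (k * t) * ‖M f‖} :=
    isClosed_le (by fun_prop) (by fun_prop)
  refine closure_minimal (fun f hf => ?_) hclosed (hdense f)
  obtain ⟨g, hg⟩ := LinearPMap.mem_domain_iff.1 hf
  rw [graph_generator] at hg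
  have hd : ∀ r ∈ Set.Ico (0 : ℝ) t, HasDerivWithinAt (fun r : ℝ => ‖M (T r.toNNReal f)‖ ^ 2)
      (2 * ⟪M (T r.toNNReal f), M (T r.toNNReal g)⟫) (Set.Ici r) r := fun r hr =>
    (M.hasFDerivAt.comp_hasDerivWithinAt r (T.hasDerivWithinAt_apply hg hr.1)).norm_sq
  have hcont : Continuous fun r : ℝ => ‖M (T r.toNNReal f)‖ ^ 2 := by
    have h := (T.continuous_apply f).comp continuous_real_toNNReal
    exact (M.continuous.comp h).norm.pow 2
  have h := le_gronwallBound_of_liminf_deriv_right_le (K := 2 * k) (ε := 0) hcont.continuousOn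
    (fun r hr _ hlt => (hd r hr).liminf_right_slope_le hlt) le_rfl (fun r hr => by
      have := hk _ (T.apply_mem_generatorGraph hg r.toNNReal)
      linarith) t ⟨t.coe_nonneg, le_rfl⟩
  rw [gronwallBound_ε0, Real.toNNReal_coe, Real.toNNReal_zero, T.map_zero, sub_zero] at h
  refine le_of_sq_le_sq (h.trans_eq ?_) (by positivity)
  rw [mul_pow, ← Real.exp_nat_mul, mul_comm]
  congr 2
  push_cast
  ring

end C0Semigroup

/-! ### The truncated distance and the optimal exponent -/

theorem setDist_nonneg {V : Type*} (ρ : PseudoMetric V ℝ) (A B : Set V) : 0 ≤ setDist ρ A B := by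
  refine Real.sInf_nonneg ?_
  rintro _ ⟨x, -, y, -, rfl⟩
  exact ρ.nonneg x y

/-- A `1`-Lipschitz function vanishing on `A`, equal to `ρ(A, B)` on `B`, with values in
`[0, ρ(A, B)]`. -/
theorem exists_lipschitz_separating {V : Type*} (ρ : PseudoMetric V ℝ) {A B : Set V}
    (hA : A.Nonempty) :
    ∃ d : V → ℝ, (∀ x y, |d x - d y| ≤ ρ x y) ∧ (∀ x ∈ A, d x = 0) ∧
      (∀ x ∈ B, d x = setDist ρ A B) ∧ ∀ x, d x ≤ setDist ρ A B := by
  have hr := setDist_nonneg ρ A B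
  set δ : V → ℝ := fun x => sInf ((fun a => ρ a x) '' A) with hδ
  have hbdd : ∀ x, BddBelow ((fun a => ρ a x) '' A) := by
    refine fun x => ⟨0, ?_⟩
    rintro _ ⟨a, -, rfl⟩
    exact ρ.nonneg a x
  have hδ0 : ∀ x, 0 ≤ δ x := by
    refine fun x => Real.sInf_nonneg ?_
    rintro _ ⟨a, -, rfl⟩
    exact ρ.nonneg a x
  have hlip : ∀ x y, δ x ≤ δ y + ρ x y := by
    intro x y
    rw [← sub_le_iff_le_add]
    refine le_csInf (hA.image _) ?_
    rintro _ ⟨a, ha, rfl⟩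
    rw [sub_le_iff_le_add]
    refine (csInf_le (hbdd x) ⟨a, ha, rfl⟩).trans ((ρ.triangle a y x).trans_eq ?_)
    rw [ρ.symm y x]
  -- The truncation keeps the exponential weight bounded.
  refine ⟨fun x => min (δ x) (setDist ρ A B), fun x y => ?_, fun x hx => ?_, fun x hx => ?_,
    fun x => min_le_right _ _⟩
  · refine (abs_min_sub_min_le_max _ _ _ _).trans ?_
    rw [sub_self, abs_zero, max_eq_left (abs_nonneg _), abs_le]
    have h1 := hlip x y
    have h2 := hlip y x
    rw [ρ.symm y x] at h2
    exact ⟨by linarith, by linarith⟩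
  · have h : δ x ≤ 0 := (csInf_le (hbdd x) ⟨x, hx, rfl⟩).trans_eq (ρ.refl x)
    change min (δ x) _ = 0
    rw [le_antisymm h (hδ0 x)]
    exact min_eq_left hr
  · refine min_eq_right (le_csInf (hA.image _) ?_)
    rintro _ ⟨a, ha, rfl⟩
    refine csInf_le ⟨0, ?_⟩ ⟨a, ha, x, hx, rfl⟩
    rintro _ ⟨y, -, z, -, rfl⟩
    exact ρ.nonneg y z

/-- The minimum of `κ ↦ (cosh(κs) - 1)t/s² - κr` is at `sinh(κs) = rs/t`; there `cosh(κs) = √(1 +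
(rs/t)²)`. -/
theorem neg_zeta_eq {s t r : ℝ} (hs : 0 < s) (ht : 0 < t) :
    (Real.cosh (Real.arsinh (r * s / t) / s * s) - 1) / s ^ 2 * t -
      Real.arsinh (r * s / t) / s * r = -zeta s t r := by
  have h : √(t ^ 2 + r ^ 2 * s ^ 2) = t * √(1 + (r * s / t) ^ 2) := by
    rw [← Real.sqrt_sq ht.le, ← Real.sqrt_mul (sq_nonneg t), Real.sqrt_sq ht.le]
    congr 1
    field_simp
  rw [zeta, h, div_mul_cancel₀ _ hs.ne', Real.cosh_arsinh]
  field_simp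
  ring

/-! ### The weighted semigroup bound and the final estimate -/

namespace WeightedGraph

variable {V : Type*} [MeasurableSpace V] [DiscreteMeasurableSpace V]
  {G : WeightedGraph V}

/-- Davies' method: a weighted norm estimate for the heat semigroup. -/
theorem IsIntrinsic.norm_exp_mul_semigroup_le {ρ : PseudoMetric V ℝ} (hρ : G.IsIntrinsic ρ)
    {s κ : ℝ} (hs : 0 < s) (hjump : ∀ x y, G.Adj x y → ρ x y ≤ s) {φ : V → ℝ}
    (hφ : ∀ x y, |φ x - φ y| ≤ κ * ρ x y) {C : ℝ} (hC : ∀ x, φ x ≤ C)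
    {M : G.ell2 →L[ℝ] G.ell2} (hM : ∀ u, ⇑(M u) = (fun x => Real.exp (φ x)) * ⇑u)
    {T : C0Semigroup G.ell2} (hT : T.generator = G.laplacian) (t : ℝ≥0) (f : G.ell2) :
    ‖M (T t f)‖ ≤
      Real.exp (((Real.cosh (κ * s) - 1) / s ^ 2 - G.spectralBottom) * t) * ‖M f‖ := by
  refine T.norm_apply_le_exp_mul M ?_ (fun p hp => ?_) t f
  · rw [hT]
    exact G.isMaxDissipative_laplacian.dense_domain
  rw [← T.graph_generator, hT, graph_laplacian] at hp
  obtain ⟨hu, hform⟩ := hp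
  have hw : ∀ x, |Real.exp (φ x)| ≤ Real.exp C := fun x => by
    rw [Real.abs_exp]
    exact Real.exp_le_exp.2 (hC x)
  have hL : ∀ x y, |Real.exp (φ x) - Real.exp (φ y)| ≤ Real.exp C * κ * ρ x y := fun x y => by
    refine (abs_exp_sub_exp_le (hC x) (hC y)).trans ?_
    rw [mul_assoc]
    exact mul_le_mul_of_nonneg_left (hφ x y) (Real.exp_pos C).le
  have hMu := hρ.mul_mem_formDomain hw hL hM hu
  have hMMu := hρ.mul_mem_formDomain hw hL hM hMu
  have h1 := hρ.form_exp_mul_ge hs hjump hφ (u := p.1) (v := M p.1) (v' := M (M p.1))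
    (fun x => congrFun (hM _) x) (fun x => congrFun (hM _) x) (G.energy_ne_top hu)
    (G.energy_ne_top hMu) (G.energy_ne_top hMMu)
  -- Testing with `M²u` gives `⟨Mu, MΔu⟩ = -Q(u, M²u)`, since `M` is symmetric.
  have h2 := hform _ hMMu
  have h3 := G.spectralBottom_mul_norm_sq_le hMu
  rw [← inner_mul_comm hM, real_inner_comm] at h2
  rw [sub_mul]
  linarith

end WeightedGraph

theorem theorem1p1 {V : Type*} [Countable V] [MeasurableSpace V] [DiscreteMeasurableSpace V]
    (G : WeightedGraph V) (ρ : PseudoMetric V ℝ) (hρ : G.IsIntrinsic ρ)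
    (s : ℝ) (hs : 0 < s) (hjump : G.jumpSize ρ = ENNReal.ofReal s) :
    G.heatSemigroup.generator = G.laplacian ∧
    ∀ (A B : Set V) (f g : G.ell2), Function.support f ⊆ A → Function.support g ⊆ B →
      ∀ t : ℝ≥0, 0 < t →
        |⟪G.heatSemigroup t f, g⟫| ≤
          Real.exp (-G.spectralBottom * t - zeta s t (setDist ρ A B)) * ‖f‖ * ‖g‖ := by
  have hT : G.heatSemigroup.generator = G.laplacian :=
    expSemigroup_generator G.isMaxDissipative_laplacian
  refine ⟨hT, fun A B f g hf hg t ht => ?_⟩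
  -- Only `A` must be nonempty: for empty `B` the infimum defaults to `0`, and the argument goes
  -- through.
  rcases A.eq_empty_or_nonempty with rfl | hA
  · have hf0 : f = 0 := Lp.ext (Eventually.of_forall fun x => by
      rw [Function.support_eq_empty_iff.1 (Set.subset_empty_iff.1 hf), G.coe_zero])
    simp [hf0]
  set r := setDist ρ A B with hr
  have hr0 : 0 ≤ r := setDist_nonneg ρ A B
  -- The minimiser of the exponent.
  set κ := Real.arsinh (r * s / t) / s with hκ
  have hκ0 : 0 ≤ κ := div_nonneg (Real.arsinh_nonneg_iff.2 (by positivity)) hs.le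
  obtain ⟨d, hdlip, hdA, hdB, hdle⟩ := exists_lipschitz_separating ρ (B := B) hA
  have hC : ∀ x, κ * d x ≤ κ * r := fun x => mul_le_mul_of_nonneg_left (hdle x) hκ0
  obtain ⟨M, hM⟩ := G.exists_mul (w := fun x => Real.exp (κ * d x)) (C := Real.exp (κ * r))
    fun x => by
      rw [Real.abs_exp]
      exact Real.exp_le_exp.2 (hC x)
  have hest := hρ.norm_exp_mul_semigroup_le hs (κ := κ)
    (fun x y h => WeightedGraph.le_of_adj_of_jumpSize_eq hs.le hjump h)
    (fun x y => by
      rw [← mul_sub, abs_mul, abs_of_nonneg hκ0]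
      exact mul_le_mul_of_nonneg_left (hdlip x y) hκ0) hC hM hT t f
  have hMf : M f = f := Lp.ext (Eventually.of_forall fun x => by
    rw [hM, Pi.mul_apply]
    by_cases hx : f x = 0
    · rw [hx, mul_zero]
    · rw [hdA x (hf hx), mul_zero, Real.exp_zero, one_mul])
  have hMg : M g = Real.exp (κ * r) • g := Lp.ext (Eventually.of_forall fun x => by
    rw [hM, G.coe_smul, Pi.mul_apply, Pi.smul_apply, smul_eq_mul]
    by_cases hx : g x = 0
    · rw [hx, mul_zero, mul_zero]
    · rw [hdB x (hg hx)])
  have h1 : ⟪G.heatSemigroup t f, g⟫ = Real.exp (-(κ * r)) * ⟪M (G.heatSemigroup t f), g⟫ := by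
    rw [WeightedGraph.inner_mul_comm hM, hMg, real_inner_smul_right, ← mul_assoc, ← Real.exp_add,
      neg_add_cancel, Real.exp_zero, one_mul]
  have h2 : Real.exp (-G.spectralBottom * t - zeta s t r) = Real.exp (-(κ * r)) *
      Real.exp (((Real.cosh (κ * s) - 1) / s ^ 2 - G.spectralBottom) * t) := by
    rw [← Real.exp_add, sub_eq_add_neg, ← neg_zeta_eq hs (NNReal.coe_pos.2 ht)]
    congr 1
    ring
  rw [hMf] at hest
  rw [h1, abs_mul, Real.abs_exp, h2, mul_assoc, mul_assoc]
  refine mul_le_mul_of_nonneg_left ?_ (Real.exp_pos _).le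
  rw [← mul_assoc]
  exact (abs_real_inner_le_norm _ _).trans (mul_le_mul_of_nonneg_right hest (norm_nonneg g))
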